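/- Let $d,n\ge 1$ be integers and let $\nu:\mathbb{R}^d\setminus\{0\}\to(0,\infty)$ be a Borel function with $\nu(-z)=\nu(z)$ and $\int_{\mathbb{R}^d}(|z|^2\wedge 1)\,\nu(z)\,dz<\infty$. Put $\psi(\xi)=\int_{\mathbb{R}^d}(1-\cos(\xi\cdot x))\,\nu(x)\,dx$ for $\xi\in\mathbb{R}^d$ and assume the Hartman–Wintner condition $\lim_{|\xi|\to\infty}\psi(\xi)/\log|\xi|=\infty$. For $t>0$ let $$p_t(x)=(2\pi)^{-d}\int_{\mathbb{R}^d}e^{-i\xi\cdot x}e^{-t\psi(\xi)}\,d\xi,\qquad x\in\mathbb{R}^d,$$ and write $p_t(x,y)=p_t(y-x)$, $\nu(x,y)=\nu(y-x)$. Assume moreover that - (P1) there is a constant $c$ such that $p_t(x,y)/t\le c\,\nu(x,y)$ for all $t>0$ and all $x\ne y$ in $\mathbb{R}^d$; - (P2) $p_t(x,y)/t\to\nu(x,y)$ as $t\to0^+$, for all $x\ne y$ in $\mathbb{R}^d$. For $t>0$ let $P_tf(x)=\int_{\mathbb{R}^d}f(y)\,p_t(x,y)\,dy$, and let $P_tF=(P_tf_1,\dots,P_tf_n)$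 for $F=(f_1,\dots,f_n)$. For $p>1$ and $w,z\in\mathbb{R}^n$ let $$\mathcal{F}_p(w,z)=|z|^p-|w|^p-p\,|w|^{p-2}w\cdot(z-w)\ \ (\ge 0),$$ where $|w|^{p-2}w:=0$ for $w=0$. Then, for every $p>1$ and every $F\in L^p(\mathbb{R}^d;\mathbb{R}^n)$, $$\int_{\mathbb{R}^d}|F(x)|^p\,dx=\int_0^\infty\int_{\mathbb{R}^d}\int_{\mathbb{R}^d}\mathcal{F}_p\big(P_tF(x),P_tF(y)\big)\,\nu(x,y)\,dx\,dy\,dt.$$ -/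

import Mathlib

open MeasureTheory Filter Topology

noncomputable section

namespace HardyStein

/-- Density of a symmetric, absolutely continuous Lévy measure on `ℝ^d`, strictly positive off the
origin. Only the values of `ν` on `ℝ^d ∖ {0}` matter: `ν 0` is an arbitrary number, and nothing is
assumed about it. -/
structure IsSymmLevyDensity {d : ℕ} (ν : EuclideanSpace ℝ (Fin d) → ℝ) : Prop where
  measurable : Measurable ν
  pos : ∀ z, z ≠ 0 → 0 < ν z
  symm : ∀ z, z ≠ 0 → ν (-z) = ν z
  integrable : Integrable (fun z => min (‖z‖ ^ 2) 1 * ν z) volume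

/-- The Lévy–Khinchine exponent `ψ(ξ) = ∫ (1 - cos (ξ · x)) ν(x) dx`. -/
def levyExponent {d : ℕ} (ν : EuclideanSpace ℝ (Fin d) → ℝ) (ξ : EuclideanSpace ℝ (Fin d)) : ℝ :=
  ∫ x, (1 - Real.cos (inner ℝ ξ x)) * ν x

/-- The Hartman–Wintner condition `ψ(ξ) / log |ξ| → ∞` as `|ξ| → ∞`. -/
def HartmanWintner {d : ℕ} (ν : EuclideanSpace ℝ (Fin d) → ℝ) : Prop :=
  Tendsto (fun ξ => levyExponent ν ξ / Real.log ‖ξ‖)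
    (Bornology.cobounded (EuclideanSpace ℝ (Fin d))) atTop

/-- The density `p_t(x) = (2π)^{-d} ∫ e^{-i ξ · x} e^{-t ψ(ξ)} dξ`. The integral is a real number
because `ψ` is even, so taking the real part only changes its type. -/
def transitionDensity {d : ℕ} (ν : EuclideanSpace ℝ (Fin d) → ℝ) (t : ℝ)
    (x : EuclideanSpace ℝ (Fin d)) : ℝ :=
  ((2 * Real.pi) ^ d)⁻¹ *
    (∫ ξ : EuclideanSpace ℝ (Fin d),
      Complex.exp (-(Complex.I * ((inner ℝ ξ x : ℝ) : ℂ))) *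
        ((Real.exp (-(t * levyExponent ν ξ)) : ℝ) : ℂ)).re

/-- Condition (P1): `p_t(x,y)/t ≤ c ν(x,y)`, where `p_t(x,y) = p_t(y-x)` and `ν(x,y) = ν(y-x)`.
As `ν` is a function on `ℝ^d ∖ {0}`, this is a condition on `x ≠ y`. -/
def ConditionP1 {d : ℕ} (ν : EuclideanSpace ℝ (Fin d) → ℝ) : Prop :=
  ∃ c : ℝ, ∀ t : ℝ, 0 < t → ∀ x y : EuclideanSpace ℝ (Fin d), x ≠ y →
    transitionDensity ν t (y - x) / t ≤ c * ν (y - x)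

/-- Condition (P2): `p_t(x,y)/t → ν(x,y)` as `t → 0+`, pointwise in `x ≠ y`. -/
def ConditionP2 {d : ℕ} (ν : EuclideanSpace ℝ (Fin d) → ℝ) : Prop :=
  ∀ x y : EuclideanSpace ℝ (Fin d), x ≠ y →
    Tendsto (fun t : ℝ => transitionDensity ν t (y - x) / t) (𝓝[>] 0) (𝓝 (ν (y - x)))

/-- The scalar semigroup: `P_0 f = f` and `P_t f(x) = ∫ f(y) p_t(x,y) dy` for `t > 0`. -/
def semigroup {d : ℕ} (ν : EuclideanSpace ℝ (Fin d) → ℝ) (t : ℝ)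
    (f : EuclideanSpace ℝ (Fin d) → ℝ) (x : EuclideanSpace ℝ (Fin d)) : ℝ :=
  if t = 0 then f x else ∫ y, f y * transitionDensity ν t (y - x)

/-- The semigroup acting on vector functions, `P_t F = (P_t f_1, …, P_t f_n)`. -/
def vecSemigroup {d n : ℕ} (ν : EuclideanSpace ℝ (Fin d) → ℝ) (t : ℝ)
    (F : EuclideanSpace ℝ (Fin d) → EuclideanSpace ℝ (Fin n)) (x : EuclideanSpace ℝ (Fin d)) :
    EuclideanSpace ℝ (Fin n) :=
  WithLp.toLp 2 fun j => semigroup ν t (fun y => F y j) x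

/-- The power `z^{⟨κ⟩} = |z|^{κ-1} z`; its value at `z = 0` is `0` for every `κ`. -/
def signedPow {n : ℕ} (κ : ℝ) (z : EuclideanSpace ℝ (Fin n)) : EuclideanSpace ℝ (Fin n) :=
  ‖z‖ ^ (κ - 1) • z

/-- The Bregman divergence `𝓕_p(w,z) = |z|^p - |w|^p - p w^{⟨p-1⟩} · (z - w)` of `|z|^p`. -/
def bregman {n : ℕ} (p : ℝ) (w z : EuclideanSpace ℝ (Fin n)) : ℝ :=
  ‖z‖ ^ p - ‖w‖ ^ p - p * inner ℝ (signedPow (p - 1) w) (z - w)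

/-- The Bregman divergence is nonnegative, so `ENNReal.ofReal` loses nothing when applied to it. -/
theorem bregman_nonneg {n : ℕ} {p : ℝ} (hp : 1 < p) (w z : EuclideanSpace ℝ (Fin n)) :
    0 ≤ bregman p w z := by
  have hp0 : 0 < p := by linarith
  unfold bregman signedPow
  rw [inner_sub_right, real_inner_smul_left, real_inner_smul_left, real_inner_self_eq_norm_sq]
  rcases eq_or_ne w 0 with rfl | hw
  · simp [Real.zero_rpow hp0.ne']
    positivity
  have hw' : 0 < ‖w‖ := norm_pos_iff.mpr hw
  have h1 : ‖w‖ ^ (p - 1 - 1) * ‖w‖ ^ 2 = ‖w‖ ^ p := by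
    rw [← Real.rpow_natCast, ← Real.rpow_add hw']; congr 1; push_cast; ring
  have h2 : ‖w‖ ^ (p - 1 - 1) * ‖w‖ = ‖w‖ ^ (p - 1) := by
    nth_rewrite 2 [← Real.rpow_one ‖w‖]
    rw [← Real.rpow_add hw']; congr 1; ring
  have h3 : ‖w‖ ^ (p - 1 - 1) * inner ℝ w z ≤ ‖w‖ ^ (p - 1) * ‖z‖ := by
    rw [← h2, mul_assoc]
    exact mul_le_mul_of_nonneg_left (real_inner_le_norm w z) (by positivity)
  have hy := Real.young_inequality_of_nonneg (a := ‖z‖) (b := ‖w‖ ^ (p - 1)) (norm_nonneg z)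
    (by positivity) (Real.HolderConjugate.conjExponent hp)
  have h4 : (‖w‖ ^ (p - 1)) ^ (p.conjExponent) = ‖w‖ ^ p := by
    rw [← Real.rpow_mul hw'.le]; congr 1
    unfold Real.conjExponent
    have : p - 1 ≠ 0 := by linarith
    field_simp
  rw [h4, Real.conjExponent] at hy
  have h5 : p * (‖z‖ * ‖w‖ ^ (p - 1)) ≤ ‖z‖ ^ p + (p - 1) * ‖w‖ ^ p := by
    have := mul_le_mul_of_nonneg_left hy hp0.le
    have hq : p - 1 ≠ 0 := by linarith
    calc _ ≤ _ := this
      _ = _ := by field_simp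
  have h6 := mul_le_mul_of_nonneg_left h3 hp0.le
  rw [h1]
  nlinarith

end HardyStein

end

/-! Write `h t` for the integral of `|P_tF|^p`. For fixed `x`, `P_sF(x)` is the mean of `F` under
the law `p_s(y - x) dy`. A Bregman divergence taken from the mean integrates to the Jensen gap,
since its linear part vanishes. Applied to `P_tF` and integrated in `x`, this shows that `h t - h (t
+ s)` is the integral of `p_s(y - x) 𝓕_p(P_{t+s}F(x), P_tF(y))`. No derivative in time is needed:
integrating over `t > 0` telescopes, and after division by `s` the total lies between `h s` and the
integral of `|F|^p`. The lower bound uses `h → 0` at infinity.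

Now let `s → 0`. By (P2), continuity of `P_tF(x)` in `t` and Fatou, the energy on the right of the
theorem is at most `∫ |F|^p`, so it is finite. For the converse, the mean minimises the expected
divergence, so replacing `P_{t+s}F(x)` by `P_tF(x)` only increases the integral. The new integrand
is at most `c` times the limiting one by (P1), so dominated convergence applies, and lower
semicontinuity of the norm at time zero recovers `∫ |F|^p`. The argument is
`IsTransitionKernel.hardyStein`; it rests on `lintegral_bregman_add`, `lintegral_bregman_le`,
`tendsto_eLpNorm_kernelAction` and `eLpNorm_le_of_tendsto`.

What remains is that `p_t` is a symmetric probability density with the semigroup property.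
Positivity comes from compound Poisson approximation, the rest from Fourier inversion, where (P1)
supplies integrability of `p_t`. -/

namespace HardyStein

open scoped RealInnerProductSpace

/-! ### The Lévy–Khinchine exponent: continuity, positivity, integrability of `e^{-tψ}`. -/

section Exponent

variable {d : ℕ} {ν : EuclideanSpace ℝ (Fin d) → ℝ}

local notation "𝔼" => EuclideanSpace ℝ (Fin d)

theorem one_sub_cos_inner_le (ξ x : 𝔼) :
    1 - Real.cos (inner ℝ ξ x) ≤ (2 + ‖ξ‖ ^ 2) * min (‖x‖ ^ 2) 1 := by
  have h1 := Real.one_sub_sq_div_two_le_cos (x := inner ℝ ξ x)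
  have h2 := Real.neg_one_le_cos (inner ℝ ξ x)
  have h3 : (inner ℝ ξ x) ^ 2 ≤ ‖ξ‖ ^ 2 * ‖x‖ ^ 2 := by
    rw [← mul_pow, ← sq_abs]
    exact pow_le_pow_left₀ (abs_nonneg _) (abs_real_inner_le_norm ξ x) 2
  rcases min_cases (‖x‖ ^ 2) 1 with ⟨h, _⟩ | ⟨h, _⟩ <;> rw [h]
  · nlinarith [sq_nonneg ‖x‖, sq_nonneg ‖ξ‖, mul_nonneg (sq_nonneg ‖x‖) (sq_nonneg ‖ξ‖)]
  · nlinarith [sq_nonneg ‖ξ‖]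

theorem IsSymmLevyDensity.mul_nonneg_of_zero (hν : IsSymmLevyDensity ν) {f : 𝔼 → ℝ}
    (hf : ∀ x, 0 ≤ f x) (hf0 : f 0 = 0) (x : 𝔼) : 0 ≤ f x * ν x := by
  rcases eq_or_ne x 0 with rfl | hx
  · simp [hf0]
  · exact mul_nonneg (hf x) (hν.pos x hx).le

theorem IsSymmLevyDensity.min_mul_nonneg (hν : IsSymmLevyDensity ν) (x : 𝔼) :
    0 ≤ min (‖x‖ ^ 2) 1 * ν x :=
  hν.mul_nonneg_of_zero (f := fun x => min (‖x‖ ^ 2) 1) (fun x => by positivity) (by simp) x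

theorem IsSymmLevyDensity.exponent_integrand_nonneg (hν : IsSymmLevyDensity ν) (ξ x : 𝔼) :
    0 ≤ (1 - Real.cos (inner ℝ ξ x)) * ν x :=
  hν.mul_nonneg_of_zero (f := fun x => 1 - Real.cos (inner ℝ ξ x))
    (fun x => by linarith [Real.cos_le_one (inner ℝ ξ x)]) (by simp) x

theorem IsSymmLevyDensity.exponent_integrand_le (hν : IsSymmLevyDensity ν) (ξ x : 𝔼) :
    (1 - Real.cos (inner ℝ ξ x)) * ν x ≤ (2 + ‖ξ‖ ^ 2) * (min (‖x‖ ^ 2) 1 * ν x) := by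
  rcases eq_or_ne x 0 with rfl | hx
  · simp
  · rw [← mul_assoc]
    exact mul_le_mul_of_nonneg_right (one_sub_cos_inner_le ξ x) (hν.pos x hx).le

theorem IsSymmLevyDensity.exponent_integrand_measurable (hν : IsSymmLevyDensity ν) (ξ : 𝔼) :
    Measurable fun x : 𝔼 => (1 - Real.cos (inner ℝ ξ x)) * ν x := by
  have := hν.measurable
  fun_prop

theorem IsSymmLevyDensity.integrable_exponent_integrand (hν : IsSymmLevyDensity ν) (ξ : 𝔼) :
    Integrable fun x : 𝔼 => (1 - Real.cos (inner ℝ ξ x)) * ν x := by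
  refine (hν.integrable.const_mul (2 + ‖ξ‖ ^ 2)).mono'
    (hν.exponent_integrand_measurable ξ).aestronglyMeasurable (ae_of_all _ fun x => ?_)
  rw [Real.norm_of_nonneg (hν.exponent_integrand_nonneg ξ x)]
  exact hν.exponent_integrand_le ξ x

theorem IsSymmLevyDensity.levyExponent_nonneg (hν : IsSymmLevyDensity ν) (ξ : 𝔼) :
    0 ≤ levyExponent ν ξ :=
  integral_nonneg (hν.exponent_integrand_nonneg ξ)

theorem levyExponent_neg (ξ : 𝔼) : levyExponent ν (-ξ) = levyExponent ν ξ := by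
  simp [levyExponent, inner_neg_left]

theorem IsSymmLevyDensity.continuous_levyExponent (hν : IsSymmLevyDensity ν) :
    Continuous (levyExponent ν) := by
  rw [continuous_iff_continuousAt]
  intro ξ₀
  refine continuousAt_of_dominated (bound := fun x => (2 + (‖ξ₀‖ + 1) ^ 2) *
    (min (‖x‖ ^ 2) 1 * ν x)) (Eventually.of_forall fun ξ =>
      (hν.exponent_integrand_measurable ξ).aestronglyMeasurable) ?_
    (hν.integrable.const_mul _) (ae_of_all _ fun x => by fun_prop)
  filter_upwards [Metric.ball_mem_nhds ξ₀ one_pos] with ξ hξ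
  refine ae_of_all _ fun x => ?_
  rw [Real.norm_of_nonneg (hν.exponent_integrand_nonneg ξ x)]
  refine (hν.exponent_integrand_le ξ x).trans
    (mul_le_mul_of_nonneg_right ?_ (hν.min_mul_nonneg x))
  have h1 : ‖ξ‖ ≤ ‖ξ₀‖ + 1 := by
    have := norm_le_norm_add_norm_sub' ξ ξ₀
    rw [Metric.mem_ball, dist_eq_norm] at hξ
    linarith
  gcongr

/-- If `ψ(ξ) = 0`, then `cos(ξ · x) = 1` for almost every `x`, hence for all `x` by continuity; but
the cosine is `-1` at `x = πξ/|ξ|²`. -/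
theorem IsSymmLevyDensity.levyExponent_pos (hν : IsSymmLevyDensity ν) [NeZero d]
    {ξ : 𝔼} (hξ : ξ ≠ 0) : 0 < levyExponent ν ξ := by
  refine lt_of_le_of_ne (hν.levyExponent_nonneg ξ) fun h => ?_
  have h0 := (integral_eq_zero_iff_of_nonneg (hν.exponent_integrand_nonneg ξ)
    (hν.integrable_exponent_integrand ξ)).1 h.symm
  have h1 : (fun x : 𝔼 => Real.cos (inner ℝ ξ x)) =ᵐ[volume] fun _ => 1 := by
    have h2 : ∀ᵐ x : 𝔼, x ≠ 0 := by simp [ae_iff, measure_singleton]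
    filter_upwards [h0, h2] with x hx hx0
    have := (mul_eq_zero.1 hx).resolve_right (hν.pos x hx0).ne'
    linarith
  have h2 := congrFun (Continuous.ae_eq_iff_eq volume (by fun_prop) continuous_const |>.1 h1)
    ((Real.pi / ‖ξ‖ ^ 2) • ξ)
  have h3 : ‖ξ‖ ≠ 0 := norm_ne_zero_iff.2 hξ
  simp only [inner_smul_right, real_inner_self_eq_norm_sq] at h2
  rw [div_mul_cancel₀ _ (pow_ne_zero 2 h3), Real.cos_pi] at h2
  norm_num at h2

theorem IsSymmLevyDensity.continuous_exp_neg_mul_levyExponent (hν : IsSymmLevyDensity ν) (t : ℝ) :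
    Continuous fun ξ : 𝔼 => Real.exp (-(t * levyExponent ν ξ)) := by
  have := hν.continuous_levyExponent
  fun_prop

/-- Hartman–Wintner gives `tψ(ξ) ≥ (d + 1) log|ξ|` for large `ξ`, that is `e^{-tψ(ξ)} ≤
|ξ|^{-(d+1)}`. -/
theorem IsSymmLevyDensity.integrable_exp_neg_mul_levyExponent (hν : IsSymmLevyDensity ν)
    (hHW : HartmanWintner ν) {t : ℝ} (ht : 0 < t) :
    Integrable fun ξ : 𝔼 => Real.exp (-(t * levyExponent ν ξ)) := by
  refine (hν.continuous_exp_neg_mul_levyExponent t).locallyIntegrable.integrable_of_isBigO_cocompact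
    (g := fun ξ : 𝔼 => (1 + ‖ξ‖) ^ (-(d + 1 : ℝ))) ?_
    ((integrable_one_add_norm (by simp)).integrableAtFilter _)
  rw [← Metric.cobounded_eq_cocompact]
  -- The constant comes from `|ξ| ≥ (1 + |ξ|)/2`, valid once `|ξ| ≥ 1`; the threshold `2` used below
  -- also makes `log|ξ|` positive.
  refine Asymptotics.IsBigO.of_bound (2 ^ (d + 1 : ℝ)) ?_
  have h1 := hHW.eventually_ge_atTop ((d + 1) / t)
  have h2 := tendsto_norm_cobounded_atTop.eventually_ge_atTop (α := 𝔼) 2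
  filter_upwards [h1, h2] with ξ h1 h2
  have hlog : 0 < Real.log ‖ξ‖ := Real.log_pos (by linarith)
  rw [le_div_iff₀ hlog, div_mul_eq_mul_div, div_le_iff₀ ht] at h1
  rw [Real.norm_of_nonneg (Real.exp_pos _).le, Real.norm_of_nonneg (by positivity)]
  calc Real.exp (-(t * levyExponent ν ξ)) ≤ Real.exp (Real.log ‖ξ‖ * (-(d + 1))) := by
        gcongr; linarith
    _ = ‖ξ‖ ^ (-(d + 1 : ℝ)) := by rw [← Real.rpow_def_of_pos (by linarith)]
    _ ≤ ((1 + ‖ξ‖) / 2) ^ (-(d + 1 : ℝ)) :=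
        Real.rpow_le_rpow_of_nonpos (by positivity) (by linarith) (by linarith)
    _ = 2 ^ (d + 1 : ℝ) * (1 + ‖ξ‖) ^ (-(d + 1 : ℝ)) := by
        rw [Real.div_rpow (by positivity) (by positivity), Real.rpow_neg (by positivity) (x := 2)]
        field_simp

end Exponent

end HardyStein

namespace HardyStein

open scoped RealInnerProductSpace FourierTransform

/-! ### Functions with nonnegative cosine transform. -/

section CosineTransform

variable {d : ℕ}

local notation "𝔼" => EuclideanSpace ℝ (Fin d)

theorem integrable_cos_mul {g : 𝔼 → ℝ} (hg : Integrable g) (x : 𝔼) :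
    Integrable fun ξ : 𝔼 => Real.cos (inner ℝ ξ x) * g ξ :=
  hg.bdd_mul (c := 1) (by fun_prop) (ae_of_all _ fun ξ => Real.abs_cos_le_one _)

theorem integrable_sin_mul {g : 𝔼 → ℝ} (hg : Integrable g) (x : 𝔼) :
    Integrable fun ξ : 𝔼 => Real.sin (inner ℝ ξ x) * g ξ :=
  hg.bdd_mul (c := 1) (by fun_prop) (ae_of_all _ fun ξ => Real.abs_sin_le_one _)

theorem continuous_cosTransform {g : 𝔼 → ℝ} (hg : Integrable g) :
    Continuous fun x : 𝔼 => ∫ ξ : 𝔼, Real.cos (inner ℝ ξ x) * g ξ := by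
  refine continuous_of_dominated (bound := fun ξ => ‖g ξ‖)
    (fun x => (integrable_cos_mul hg x).aestronglyMeasurable) (fun x => ae_of_all _ fun ξ => ?_)
    hg.norm (ae_of_all _ fun ξ => by fun_prop)
  rw [norm_mul]
  exact mul_le_of_le_one_left (norm_nonneg _) (Real.abs_cos_le_one _)

theorem abs_cosTransform_le {g : 𝔼 → ℝ} (hg : Integrable g) (x : 𝔼) :
    |∫ ξ : 𝔼, Real.cos (inner ℝ ξ x) * g ξ| ≤ ∫ ξ : 𝔼, |g ξ| := by
  refine (abs_integral_le_integral_abs).trans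
    (integral_mono (integrable_cos_mul hg x).abs hg.abs fun ξ => ?_)
  simp only [abs_mul]
  exact mul_le_of_le_one_left (abs_nonneg _) (Real.abs_cos_le_one _)

theorem integral_sin_mul_eq_zero {g : 𝔼 → ℝ} (he : ∀ ξ, g (-ξ) = g ξ) (x : 𝔼) :
    ∫ ξ : 𝔼, Real.sin (inner ℝ ξ x) * g ξ = 0 := by
  have h := integral_neg_eq_self (fun ξ : 𝔼 => Real.sin (inner ℝ ξ x) * g ξ) volume
  simp only [inner_neg_left, Real.sin_neg, he, neg_mul, integral_neg] at h
  linarith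

theorem integral_cexp_mul_of_even {g : 𝔼 → ℝ} (hg : Integrable g) (he : ∀ ξ, g (-ξ) = g ξ)
    (x : 𝔼) :
    ∫ ξ : 𝔼, Complex.exp (((inner ℝ ξ x : ℝ) : ℂ) * Complex.I) * (g ξ : ℂ) =
      ((∫ ξ : 𝔼, Real.cos (inner ℝ ξ x) * g ξ : ℝ) : ℂ) := by
  have h : ∀ ξ : 𝔼, Complex.exp (((inner ℝ ξ x : ℝ) : ℂ) * Complex.I) * (g ξ : ℂ) =
      ((Real.cos (inner ℝ ξ x) * g ξ : ℝ) : ℂ) +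
        ((Real.sin (inner ℝ ξ x) * g ξ : ℝ) : ℂ) * Complex.I := fun ξ => by
    rw [Complex.exp_mul_I]; push_cast; ring
  simp_rw [h]
  rw [integral_add (integrable_cos_mul hg x).ofReal ((integrable_sin_mul hg x).ofReal.mul_const _),
    integral_mul_const, integral_complex_ofReal, integral_complex_ofReal, integral_sin_mul_eq_zero he]
  simp

theorem integrable_exp_neg_mul_norm_sq {σ : ℝ} (hσ : 0 < σ) :
    Integrable fun ξ : 𝔼 => Real.exp (-σ * ‖ξ‖ ^ 2) := by
  have := (GaussianFourier.integrable_cexp_neg_mul_sq_norm_add (V := 𝔼) (b := σ)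
    (by simpa using hσ) 0 0).re
  refine this.congr (ae_of_all _ fun ξ => ?_)
  simp only [zero_mul, add_zero]
  rw [show Complex.exp (-(σ : ℂ) * (‖ξ‖ : ℂ) ^ 2) = ((Real.exp (-σ * ‖ξ‖ ^ 2) : ℝ) : ℂ) by
    push_cast; rfl]
  rfl

theorem cosTransform_gaussian_nonneg {σ : ℝ} (hσ : 0 < σ) (x : 𝔼) :
    0 ≤ ∫ ξ : 𝔼, Real.cos (inner ℝ ξ x) * Real.exp (-σ * ‖ξ‖ ^ 2) := by
  have hi := integrable_exp_neg_mul_norm_sq (d := d) hσ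
  have h := GaussianFourier.integral_cexp_neg_mul_sq_norm_add (V := 𝔼) (b := σ)
    (by simpa using hσ) Complex.I x
  have h2 := integral_cexp_mul_of_even hi (by simp) x
  have h3 : ∫ ξ : 𝔼, Complex.exp (((inner ℝ ξ x : ℝ) : ℂ) * Complex.I) *
      ((Real.exp (-σ * ‖ξ‖ ^ 2) : ℝ) : ℂ) =
      (((Real.pi / σ) ^ (Module.finrank ℝ 𝔼 / 2 : ℝ) * Real.exp (-(‖x‖ ^ 2 / (4 * σ))) : ℝ) : ℂ) := by
    push_cast
    rw [Complex.ofReal_cpow (by positivity)]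
    push_cast
    convert h using 2
    · ext ξ
      rw [← Complex.exp_add, real_inner_comm, mul_comm Complex.I, add_comm]
    · congr 1
      rw [Complex.I_sq]; ring
  rw [h2] at h3
  rw [Complex.ofReal_injective h3]
  positivity

/-- Multiplying by the cosine transform of a nonnegative function preserves nonnegativity of the
cosine transform. -/
theorem cosTransform_mul_nonneg {g k : 𝔼 → ℝ} (hg : Integrable g)
    (hg0 : ∀ x : 𝔼, 0 ≤ ∫ ξ : 𝔼, Real.cos (inner ℝ ξ x) * g ξ) (hk : Integrable k)
    (hk0 : ∀ z, 0 ≤ k z) (x : 𝔼) :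
    0 ≤ ∫ ξ : 𝔼, Real.cos (inner ℝ ξ x) *
      ((∫ z : 𝔼, Real.cos (inner ℝ z ξ) * k z) * g ξ) := by
  have hprod : Integrable (fun q : 𝔼 × 𝔼 => (Real.cos (inner ℝ q.1 x) * Real.cos (inner ℝ q.2 q.1)) *
      (g q.1 * k q.2)) (volume.prod volume) := by
    refine (hg.mul_prod hk).bdd_mul (c := 1) (by fun_prop) (ae_of_all _ fun q => ?_)
    rw [norm_mul]
    exact mul_le_one₀ (Real.abs_cos_le_one _) (norm_nonneg _) (Real.abs_cos_le_one _)
  have h1 : ∀ ξ : 𝔼, Real.cos (inner ℝ ξ x) * ((∫ z : 𝔼, Real.cos (inner ℝ z ξ) * k z) * g ξ) =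
      ∫ z : 𝔼, (Real.cos (inner ℝ ξ x) * Real.cos (inner ℝ z ξ)) * (g ξ * k z) := fun ξ => by
    rw [← integral_mul_const, ← integral_const_mul]
    congr 1; ext z; ring
  simp_rw [h1]
  rw [integral_integral_swap hprod]
  refine integral_nonneg fun z => ?_
  -- The product-to-sum formula turns the inner integral into an average of the transform of `g` at
  -- `x + z` and `x - z`.
  have h2 : ∀ ξ : 𝔼, (Real.cos (inner ℝ ξ x) * Real.cos (inner ℝ z ξ)) * (g ξ * k z) =
      (k z / 2) * (Real.cos (inner ℝ ξ (x + z)) * g ξ + Real.cos (inner ℝ ξ (x - z)) * g ξ) :=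
    fun ξ => by
      rw [inner_add_right, inner_sub_right, Real.cos_add, Real.cos_sub, real_inner_comm z ξ]; ring
  simp_rw [h2]
  rw [integral_const_mul, integral_add (integrable_cos_mul hg _) (integrable_cos_mul hg _)]
  exact mul_nonneg (div_nonneg (hk0 z) (by norm_num)) (add_nonneg (hg0 _) (hg0 _))

/-- Expand the exponential: each `K^m g` has nonnegative transform by induction, and the series may
be integrated termwise because it is dominated by `e^{tL}|g|`. This is convolution with a compound
Poisson law, up to normalisation. -/
theorem cosTransform_exp_mul_nonneg {g k : 𝔼 → ℝ} (hg : Integrable g)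
    (hg0 : ∀ x : 𝔼, 0 ≤ ∫ ξ : 𝔼, Real.cos (inner ℝ ξ x) * g ξ) (hk : Integrable k)
    (hk0 : ∀ z, 0 ≤ k z) {t : ℝ} (ht : 0 ≤ t) (x : 𝔼) :
    0 ≤ ∫ ξ : 𝔼, Real.cos (inner ℝ ξ x) *
      (Real.exp (t * ∫ z : 𝔼, Real.cos (inner ℝ z ξ) * k z) * g ξ) := by
  set K : 𝔼 → ℝ := fun ξ => ∫ z : 𝔼, Real.cos (inner ℝ z ξ) * k z with hK
  have hKc : Continuous K := continuous_cosTransform hk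
  set L : ℝ := ∫ z, |k z|
  have hKL : ∀ ξ, |K ξ| ≤ L := fun ξ => abs_cosTransform_le hk ξ
  have hpow : ∀ m : ℕ, Integrable (fun ξ => K ξ ^ m * g ξ) ∧
      ∀ x : 𝔼, 0 ≤ ∫ ξ : 𝔼, Real.cos (inner ℝ ξ x) * (K ξ ^ m * g ξ) := by
    intro m
    induction m with
    | zero => simpa using ⟨hg, hg0⟩
    | succ m ih =>
      have he : (fun ξ => K ξ ^ (m + 1) * g ξ) = fun ξ => K ξ * (K ξ ^ m * g ξ) := by
        ext ξ; ring
      refine ⟨?_, fun x => ?_⟩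
      · rw [he]
        exact ih.1.bdd_mul (c := L) hKc.aestronglyMeasurable (ae_of_all _ hKL)
      · have := cosTransform_mul_nonneg ih.1 ih.2 hk hk0 x
        convert this using 4 with ξ
        rw [pow_succ', mul_assoc]
  have hsum : HasSum (fun m : ℕ => ∫ ξ : 𝔼, t ^ m / m.factorial *
      (Real.cos (inner ℝ ξ x) * (K ξ ^ m * g ξ)))
      (∫ ξ : 𝔼, Real.cos (inner ℝ ξ x) * (Real.exp (t * K ξ) * g ξ)) := by
    refine hasSum_integral_of_dominated_convergence
      (fun m ξ => (t * L) ^ m / m.factorial * |g ξ|) (fun m => ?_) (fun m => ae_of_all _ fun ξ => ?_)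
      (ae_of_all _ fun ξ => ?_) ?_ (ae_of_all _ fun ξ => ?_)
    · exact ((integrable_cos_mul (hpow m).1 x).const_mul _).aestronglyMeasurable
    · rw [norm_mul, norm_mul, norm_mul, norm_pow, Real.norm_of_nonneg (by positivity : 0 ≤ t ^ m / m.factorial),
        mul_pow, mul_div_right_comm, mul_assoc]
      refine mul_le_mul_of_nonneg_left ?_ (by positivity)
      refine (mul_le_of_le_one_left (by positivity) (Real.abs_cos_le_one _)).trans ?_
      gcongr
      · exact hKL ξ
      · rfl
    · exact (Real.summable_pow_div_factorial _).mul_right _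
    · simp_rw [tsum_mul_right]
      exact hg.abs.const_mul _
    · have := (NormedSpace.expSeries_div_hasSum_exp (t * K ξ)).mul_right
        (Real.cos (inner ℝ ξ x) * g ξ)
      rw [← Real.exp_eq_exp_ℝ] at this
      have h1 : ∀ E : ℝ, Real.cos (inner ℝ ξ x) * (E * g ξ) = E * (Real.cos (inner ℝ ξ x) * g ξ) :=
        fun E => by ring
      rw [h1]
      refine this.congr_fun fun m => ?_
      rw [mul_pow]; ring
  refine hsum.nonneg fun m => ?_
  rw [integral_const_mul]
  exact mul_nonneg (by positivity) ((hpow m).2 x)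

end CosineTransform

end HardyStein

namespace HardyStein

open scoped RealInnerProductSpace FourierTransform

/-! ### Positivity, bounds and regularity of the densities `p_t`. -/

section Density

variable {d : ℕ} {ν : EuclideanSpace ℝ (Fin d) → ℝ}

local notation "𝔼" => EuclideanSpace ℝ (Fin d)

/-- The truncations `min((m+1)|z|², 1) ν(z)` are integrable and increase to `ν` off the origin. For
each of them `e^{-tψ_m}` is a positive constant times `exp(t K_m)`, with `K_m` the cosine transform
of the truncation, so the compound Poisson lemma applies. The Gaussian factor starts that lemma and
dominates the limit in `m`. -/
theorem IsSymmLevyDensity.cosTransform_exp_gaussian_nonneg (hν : IsSymmLevyDensity ν)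
    {t : ℝ} (ht : 0 < t) {σ : ℝ} (hσ : 0 < σ) (x : 𝔼) :
    0 ≤ ∫ ξ : 𝔼, Real.cos (inner ℝ ξ x) *
      (Real.exp (-(t * levyExponent ν ξ)) * Real.exp (-σ * ‖ξ‖ ^ 2)) := by
  have hg : Integrable fun ξ : 𝔼 => Real.exp (-σ * ‖ξ‖ ^ 2) := integrable_exp_neg_mul_norm_sq hσ
  set k : ℕ → 𝔼 → ℝ := fun m z => min ((m + 1) * ‖z‖ ^ 2) 1 * ν z with hk
  have hk0 : ∀ m z, 0 ≤ k m z := fun m =>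
    hν.mul_nonneg_of_zero (f := fun z => min ((m + 1) * ‖z‖ ^ 2) 1) (fun z => by positivity) (by simp)
  have hkm : ∀ m, Measurable (k m) := fun m => by
    have := hν.measurable
    fun_prop
  have hkle : ∀ m z, k m z ≤ (m + 1) * (min (‖z‖ ^ 2) 1 * ν z) := fun m z => by
    rcases eq_or_ne z 0 with rfl | hz
    · simp [hk]
    · rw [← mul_assoc]
      refine mul_le_mul_of_nonneg_right ?_ (hν.pos z hz).le
      rw [mul_min_of_nonneg _ _ (by positivity)]
      exact min_le_min le_rfl (by simp)
  have hki : ∀ m, Integrable (k m) := fun m =>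
    (hν.integrable.const_mul (m + 1 : ℝ)).mono' (hkm m).aestronglyMeasurable
      (ae_of_all _ fun z => by rw [Real.norm_of_nonneg (hk0 m z)]; exact hkle m z)
  set ψ : ℕ → 𝔼 → ℝ := fun m ξ => ∫ z, k m z - Real.cos (inner ℝ z ξ) * k m z with hψ
  have hψ0 : ∀ m ξ, 0 ≤ ψ m ξ := fun m ξ => integral_nonneg fun z => by
    have := mul_le_of_le_one_left (hk0 m z) (Real.cos_le_one (inner ℝ z ξ))
    simpa using this
  have hψe : ∀ m ξ, ψ m ξ = (∫ z, k m z) - ∫ z, Real.cos (inner ℝ z ξ) * k m z := fun m ξ =>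
    integral_sub (hki m) (integrable_cos_mul (hki m) ξ)
  have hψc : ∀ m, Continuous (ψ m) := fun m => by
    simp_rw [funext (hψe m)]
    exact continuous_const.sub (continuous_cosTransform (hki m))
  have hlim : ∀ ξ, Tendsto (fun m => ψ m ξ) atTop (𝓝 (levyExponent ν ξ)) := fun ξ => by
    refine tendsto_integral_of_dominated_convergence
      (fun z => (1 - Real.cos (inner ℝ ξ z)) * ν z)
      (fun m => ((hki m).sub (integrable_cos_mul (hki m) ξ)).aestronglyMeasurable)
      (hν.integrable_exponent_integrand ξ) (fun m => ae_of_all _ fun z => ?_)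
      (ae_of_all _ fun z => ?_)
    · have h1 : k m z - Real.cos (inner ℝ z ξ) * k m z =
          min ((m + 1) * ‖z‖ ^ 2) 1 * ((1 - Real.cos (inner ℝ ξ z)) * ν z) := by
        rw [real_inner_comm]; simp only [hk]; ring
      have h2 := hν.exponent_integrand_nonneg ξ z
      rw [h1, Real.norm_of_nonneg (mul_nonneg (by positivity) h2)]
      exact mul_le_of_le_one_left h2 (min_le_right _ _)
    · rcases eq_or_ne z 0 with rfl | hz
      · simp
      refine tendsto_const_nhds.congr' ?_
      have h1 : Tendsto (fun m : ℕ => ((m : ℝ) + 1) * ‖z‖ ^ 2) atTop atTop :=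
        (tendsto_natCast_atTop_atTop.atTop_add tendsto_const_nhds).atTop_mul_const
          (by have := norm_pos_iff.2 hz; positivity)
      filter_upwards [h1.eventually_ge_atTop 1] with m hm
      simp only [hk]
      rw [min_eq_right hm, real_inner_comm]; ring
  refine ge_of_tendsto' (x := atTop) (f := fun m : ℕ => ∫ ξ : 𝔼, Real.cos (inner ℝ ξ x) *
      (Real.exp (-(t * ψ m ξ)) * Real.exp (-σ * ‖ξ‖ ^ 2))) ?_ fun m => ?_
  · refine tendsto_integral_of_dominated_convergence (fun ξ => Real.exp (-σ * ‖ξ‖ ^ 2))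
      (fun m => ?_) hg (fun m => ae_of_all _ fun ξ => ?_) (ae_of_all _ fun ξ => ?_)
    · have := hψc m
      exact (by fun_prop : Continuous _).aestronglyMeasurable
    · rw [norm_mul, norm_mul, Real.norm_of_nonneg (Real.exp_pos _).le,
        Real.norm_of_nonneg (Real.exp_pos _).le, ← mul_assoc]
      refine mul_le_of_le_one_left (Real.exp_pos _).le (mul_le_one₀ (Real.abs_cos_le_one _)
        (Real.exp_pos _).le (Real.exp_le_one_iff.2 ?_))
      have := mul_nonneg ht.le (hψ0 m ξ)
      linarith
    · exact ((Real.continuous_exp.tendsto _).comp ((hlim ξ).const_mul t).neg).mul_const _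
        |>.const_mul _
  · have h := cosTransform_exp_mul_nonneg hg (cosTransform_gaussian_nonneg hσ) (hki m) (hk0 m)
      ht.le x
    have h2 : ∀ ξ : 𝔼, Real.cos (inner ℝ ξ x) *
        (Real.exp (-(t * ψ m ξ)) * Real.exp (-σ * ‖ξ‖ ^ 2)) =
        Real.exp (-(t * ∫ z, k m z)) * (Real.cos (inner ℝ ξ x) *
          (Real.exp (t * ∫ z : 𝔼, Real.cos (inner ℝ z ξ) * k m z) * Real.exp (-σ * ‖ξ‖ ^ 2))) :=
      fun ξ => by
        rw [hψe, mul_sub, neg_sub, sub_eq_add_neg, Real.exp_add]; ring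
    simp_rw [h2]
    rw [integral_const_mul]
    exact mul_nonneg (Real.exp_pos _).le h

/-- The Gaussian factor is removed by sending its parameter to zero, with `e^{-tψ}` as dominating
function. -/
theorem IsSymmLevyDensity.cosTransform_exp_nonneg (hν : IsSymmLevyDensity ν)
    (hHW : HartmanWintner ν) {t : ℝ} (ht : 0 < t) (x : 𝔼) :
    0 ≤ ∫ ξ : 𝔼, Real.cos (inner ℝ ξ x) * Real.exp (-(t * levyExponent ν ξ)) := by
  have hc := hν.continuous_exp_neg_mul_levyExponent t
  refine ge_of_tendsto' (x := atTop) (f := fun m : ℕ => ∫ ξ : 𝔼, Real.cos (inner ℝ ξ x) *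
      (Real.exp (-(t * levyExponent ν ξ)) * Real.exp (-(1 / ((m : ℝ) + 1)) * ‖ξ‖ ^ 2))) ?_
      fun m => hν.cosTransform_exp_gaussian_nonneg ht (by positivity) x
  refine tendsto_integral_of_dominated_convergence (fun ξ => Real.exp (-(t * levyExponent ν ξ)))
      (fun m => ?_) (hν.integrable_exp_neg_mul_levyExponent hHW ht)
      (fun m => ae_of_all _ fun ξ => ?_) (ae_of_all _ fun ξ => ?_)
  · exact (by fun_prop : Continuous _).aestronglyMeasurable
  · rw [norm_mul, norm_mul, Real.norm_of_nonneg (Real.exp_pos _).le,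
      Real.norm_of_nonneg (Real.exp_pos _).le, mul_comm (Real.exp _), ← mul_assoc]
    refine mul_le_of_le_one_left (Real.exp_pos _).le (mul_le_one₀ (Real.abs_cos_le_one _)
      (Real.exp_pos _).le (Real.exp_le_one_iff.2 ?_))
    rw [neg_mul, neg_nonpos]
    positivity
  · have h := (((tendsto_one_div_add_atTop_nhds_zero_nat (𝕜 := ℝ)).neg.mul_const (‖ξ‖ ^ 2)).rexp).const_mul
      (Real.exp (-(t * levyExponent ν ξ))) |>.const_mul (Real.cos (inner ℝ ξ x))
    simpa using h

theorem IsSymmLevyDensity.transitionDensity_eq (hν : IsSymmLevyDensity ν)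
    (hHW : HartmanWintner ν) {t : ℝ} (ht : 0 < t) (x : 𝔼) :
    transitionDensity ν t x = ((2 * Real.pi) ^ d)⁻¹ *
      ∫ ξ : 𝔼, Real.cos (inner ℝ ξ x) * Real.exp (-(t * levyExponent ν ξ)) := by
  have h := integral_cexp_mul_of_even (hν.integrable_exp_neg_mul_levyExponent hHW ht)
    (fun ξ => by rw [levyExponent_neg]) (-x)
  rw [transitionDensity]
  congr 1
  rw [← Complex.ofReal_re (∫ ξ : 𝔼, _)]
  simp only [inner_neg_right, Real.cos_neg] at h
  rw [← h]
  congr 2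
  ext ξ
  push_cast
  ring_nf

theorem IsSymmLevyDensity.transitionDensity_nonneg (hν : IsSymmLevyDensity ν)
    (hHW : HartmanWintner ν) {t : ℝ} (ht : 0 < t) (x : 𝔼) : 0 ≤ transitionDensity ν t x := by
  rw [hν.transitionDensity_eq hHW ht]
  exact mul_nonneg (by positivity) (hν.cosTransform_exp_nonneg hHW ht x)

theorem IsSymmLevyDensity.transitionDensity_neg (hν : IsSymmLevyDensity ν)
    (hHW : HartmanWintner ν) {t : ℝ} (ht : 0 < t) (x : 𝔼) :
    transitionDensity ν t (-x) = transitionDensity ν t x := by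
  simp [hν.transitionDensity_eq hHW ht, inner_neg_right]

theorem IsSymmLevyDensity.continuous_transitionDensity (hν : IsSymmLevyDensity ν)
    (hHW : HartmanWintner ν) {t : ℝ} (ht : 0 < t) : Continuous (transitionDensity ν t) := by
  rw [funext (hν.transitionDensity_eq hHW ht)]
  exact continuous_const.mul
    (continuous_cosTransform (hν.integrable_exp_neg_mul_levyExponent hHW ht))

/-- The value `p_t(0) = (2π)^{-d} ∫ e^{-t ψ(ξ)} dξ`, which is the maximum of `p_t`. -/
noncomputable def densityBound (ν : 𝔼 → ℝ) (t : ℝ) : ℝ :=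
  ((2 * Real.pi) ^ d)⁻¹ * ∫ ξ : 𝔼, Real.exp (-(t * levyExponent ν ξ))

theorem densityBound_nonneg (t : ℝ) : 0 ≤ densityBound ν t :=
  mul_nonneg (by positivity) (integral_nonneg fun ξ => (Real.exp_pos _).le)

theorem IsSymmLevyDensity.transitionDensity_le (hν : IsSymmLevyDensity ν)
    (hHW : HartmanWintner ν) {t : ℝ} (ht : 0 < t) (x : 𝔼) :
    transitionDensity ν t x ≤ densityBound ν t := by
  rw [hν.transitionDensity_eq hHW ht, densityBound]
  have hi := hν.integrable_exp_neg_mul_levyExponent hHW ht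
  refine mul_le_mul_of_nonneg_left (integral_mono (integrable_cos_mul hi x) hi fun ξ => ?_)
    (by positivity)
  exact mul_le_of_le_one_left (Real.exp_pos _).le (Real.cos_le_one _)

theorem IsSymmLevyDensity.densityBound_antitone (hν : IsSymmLevyDensity ν)
    (hHW : HartmanWintner ν) {s t : ℝ} (hs : 0 < s) (hst : s ≤ t) :
    densityBound ν t ≤ densityBound ν s := by
  refine mul_le_mul_of_nonneg_left (integral_mono
    (hν.integrable_exp_neg_mul_levyExponent hHW (hs.trans_le hst))
    (hν.integrable_exp_neg_mul_levyExponent hHW hs) fun ξ => ?_) (by positivity)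
  have := mul_le_mul_of_nonneg_right hst (hν.levyExponent_nonneg ξ)
  exact Real.exp_le_exp.2 (by linarith)

/-- Dominated convergence under `e^{-ψ}`, since `ψ > 0` off the origin. This uniform decay of `p_t`
makes the semigroup vanish at infinity in time. -/
theorem IsSymmLevyDensity.tendsto_densityBound (hν : IsSymmLevyDensity ν)
    (hHW : HartmanWintner ν) [NeZero d] : Tendsto (densityBound ν) atTop (𝓝 0) := by
  rw [← mul_zero ((2 * Real.pi) ^ d)⁻¹, ← integral_zero 𝔼 ℝ]
  refine Tendsto.const_mul _ (tendsto_integral_filter_of_dominated_convergence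
    (fun ξ => Real.exp (-(1 * levyExponent ν ξ))) (Eventually.of_forall fun t =>
      (hν.continuous_exp_neg_mul_levyExponent t).aestronglyMeasurable) ?_
      (hν.integrable_exp_neg_mul_levyExponent hHW one_pos) ?_)
  · filter_upwards [eventually_ge_atTop 1] with t ht
    refine ae_of_all _ fun ξ => ?_
    rw [Real.norm_of_nonneg (Real.exp_pos _).le]
    have := mul_le_mul_of_nonneg_right ht (hν.levyExponent_nonneg ξ)
    exact Real.exp_le_exp.2 (by linarith)
  · have h2 : ∀ᵐ x : 𝔼, x ≠ 0 := by simp [ae_iff, measure_singleton]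
    filter_upwards [h2] with ξ hξ
    exact Real.tendsto_exp_neg_atTop_nhds_zero.comp
      (tendsto_id.atTop_mul_const (hν.levyExponent_pos hξ))

theorem IsSymmLevyDensity.continuousAt_transitionDensity_time (hν : IsSymmLevyDensity ν)
    (hHW : HartmanWintner ν) {t : ℝ} (ht : 0 < t) (x : 𝔼) :
    ContinuousAt (fun s => transitionDensity ν s x) t := by
  have h : (fun s => ((2 * Real.pi) ^ d)⁻¹ *
      ∫ ξ : 𝔼, Real.cos (inner ℝ ξ x) * Real.exp (-(s * levyExponent ν ξ))) =ᶠ[𝓝 t]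
      fun s => transitionDensity ν s x := by
    filter_upwards [lt_mem_nhds ht] with s hs
    rw [hν.transitionDensity_eq hHW hs]
  refine ContinuousAt.congr (continuousAt_const.mul ?_) h
  have hi := hν.integrable_exp_neg_mul_levyExponent hHW (half_pos ht)
  refine continuousAt_of_dominated
    (bound := fun ξ => Real.exp (-(t / 2 * levyExponent ν ξ)))
    (Eventually.of_forall fun s => ?_) ?_ hi (ae_of_all _ fun ξ => by fun_prop)
  · have := hν.continuous_exp_neg_mul_levyExponent s
    exact (by fun_prop : Continuous _).aestronglyMeasurable
  · filter_upwards [lt_mem_nhds (half_lt_self ht)] with s hs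
    refine ae_of_all _ fun ξ => ?_
    rw [norm_mul, Real.norm_of_nonneg (Real.exp_pos _).le]
    refine (mul_le_of_le_one_left (Real.exp_pos _).le (Real.abs_cos_le_one _)).trans ?_
    have := mul_le_mul_of_nonneg_right hs.le (hν.levyExponent_nonneg ξ)
    exact Real.exp_le_exp.2 (by linarith)

theorem IsSymmLevyDensity.measurable_transitionDensity (hν : IsSymmLevyDensity ν) :
    Measurable fun q : ℝ × 𝔼 => transitionDensity ν q.1 q.2 := by
  have hψ := hν.continuous_levyExponent
  have hc : Continuous fun q : (ℝ × 𝔼) × 𝔼 =>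
      Complex.exp (-(Complex.I * ((inner ℝ q.2 q.1.2 : ℝ) : ℂ))) *
        ((Real.exp (-(q.1.1 * levyExponent ν q.2)) : ℝ) : ℂ) := by fun_prop
  have h := (hc.stronglyMeasurable.integral_prod_right' (ν := (volume : Measure 𝔼))).measurable
  exact (Complex.measurable_re.comp h).const_mul _

end Density

end HardyStein

namespace HardyStein

open scoped RealInnerProductSpace FourierTransform

/-! ### `p_t` as a probability density: mass one, Chapman–Kolmogorov, small-time moment. -/

section Kernel

variable {d : ℕ} {ν : EuclideanSpace ℝ (Fin d) → ℝ}

local notation "𝔼" => EuclideanSpace ℝ (Fin d)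

theorem ConditionP1.exists_bound (hP1 : ConditionP1 ν) (hν : IsSymmLevyDensity ν) :
    ∃ c : ℝ, 0 ≤ c ∧ ∀ t : ℝ, 0 < t → ∀ z : 𝔼, z ≠ 0 → transitionDensity ν t z ≤ c * ν z * t := by
  obtain ⟨c, hc⟩ := hP1
  refine ⟨|c|, abs_nonneg c, fun t ht z hz => ?_⟩
  have h := hc t ht 0 z hz.symm
  rw [sub_zero, div_le_iff₀ ht] at h
  refine h.trans ?_
  have := mul_le_mul_of_nonneg_right (le_abs_self c) (hν.pos z hz).le
  gcongr

/-- On compact time intervals the densities have a bounded integrable majorant. -/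
theorem IsSymmLevyDensity.exists_majorant (hν : IsSymmLevyDensity ν)
    (hHW : HartmanWintner ν) (hP1 : ConditionP1 ν) {a b : ℝ} (ha : 0 < a) :
    ∃ (m : 𝔼 → ℝ) (M : ℝ), Measurable m ∧ Integrable m ∧ (∀ z, 0 ≤ m z) ∧ (∀ z, m z ≤ M) ∧
      ∀ t ∈ Set.Icc a b, ∀ z, transitionDensity ν t z ≤ m z := by
  obtain ⟨c, hc0, hc⟩ := hP1.exists_bound hν
  have hM := densityBound_nonneg (ν := ν) a
  have hi := hν.integrable.const_mul (c * |b|)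
  have hν' := hν.measurable
  have hj : Integrable ((Metric.ball (0 : 𝔼) 1).indicator fun _ => densityBound ν a) :=
    (integrable_indicator_iff measurableSet_ball).2 (integrableOn_const measure_ball_lt_top.ne)
  have h0 : ∀ z : 𝔼, 0 ≤ (Metric.ball (0 : 𝔼) 1).indicator (fun _ => densityBound ν a) z :=
    fun z => Set.indicator_nonneg (fun _ _ => hM) z
  have h1 : ∀ z : 𝔼, 0 ≤ c * |b| * (min (‖z‖ ^ 2) 1 * ν z) := fun z =>
    mul_nonneg (by positivity) (hν.min_mul_nonneg z)
  -- The majorant uses `p_t ≤ p_a(0)` on the unit ball and (P1) outside it, where the truncation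
  -- `min(|z|², 1)` equals one. The outer minimum with `p_a(0)` keeps it bounded, although `ν` need
  -- not be.
  have hmeas : Measurable fun z : 𝔼 => min (densityBound ν a)
      ((Metric.ball (0 : 𝔼) 1).indicator (fun _ => densityBound ν a) z +
        c * |b| * (min (‖z‖ ^ 2) 1 * ν z)) := by
    have : Measurable ((Metric.ball (0 : 𝔼) 1).indicator fun _ => densityBound ν a) :=
      measurable_const.indicator measurableSet_ball
    fun_prop
  refine ⟨_, densityBound ν a, hmeas, (hj.add hi).mono' hmeas.aestronglyMeasurable
    (ae_of_all _ fun z => ?_), fun z => le_min hM (add_nonneg (h0 z) (h1 z)),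
    fun z => min_le_left _ _, fun t ht z => ?_⟩
  · rw [Real.norm_of_nonneg (le_min hM (add_nonneg (h0 z) (h1 z)))]
    exact min_le_right _ _
  · have ht0 := ha.trans_le ht.1
    have hle := (hν.transitionDensity_le hHW ht0 z).trans (hν.densityBound_antitone hHW ha ht.1)
    refine le_min hle ?_
    by_cases hz : z ∈ Metric.ball (0 : 𝔼) 1
    · rw [Set.indicator_of_mem hz]
      linarith [h1 z]
    · have hz1 : 1 ≤ ‖z‖ := by simpa using hz
      have hz0 : z ≠ 0 := norm_pos_iff.1 (by linarith)
      rw [Set.indicator_of_notMem hz, min_eq_right (one_le_pow₀ hz1), zero_add, one_mul]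
      refine (hc t ht0 z hz0).trans ?_
      have h2 := ht.2.trans (le_abs_self b)
      have h3 := mul_le_mul_of_nonneg_left h2 (mul_nonneg hc0 (hν.pos z hz0).le)
      linarith

theorem IsSymmLevyDensity.integrable_transitionDensity (hν : IsSymmLevyDensity ν)
    (hHW : HartmanWintner ν) (hP1 : ConditionP1 ν) {t : ℝ} (ht : 0 < t) :
    Integrable (transitionDensity ν t) := by
  obtain ⟨m, M, -, hmi, -, -, hm⟩ := hν.exists_majorant hHW hP1 (b := t) ht
  refine hmi.mono' (hν.continuous_transitionDensity hHW ht).aestronglyMeasurable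
    (ae_of_all _ fun z => ?_)
  rw [Real.norm_of_nonneg (hν.transitionDensity_nonneg hHW ht z)]
  exact hm t ⟨le_rfl, le_rfl⟩ z

/-- The characteristic function of `p_t` is `e^{-tψ}`. -/
theorem IsSymmLevyDensity.cosTransform_transitionDensity (hν : IsSymmLevyDensity ν)
    (hHW : HartmanWintner ν) (hP1 : ConditionP1 ν) {t : ℝ} (ht : 0 < t) (ξ : 𝔼) :
    ∫ x : 𝔼, Real.cos (inner ℝ x ξ) * transitionDensity ν t x =
      Real.exp (-(t * levyExponent ν ξ)) := by
  set q : 𝔼 → ℂ := fun ξ => ((Real.exp (-(t * levyExponent ν ξ)) : ℝ) : ℂ) with hq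
  have hqi := hν.integrable_exp_neg_mul_levyExponent hHW ht
  have hpi := hν.integrable_transitionDensity hHW hP1 ht
  have hπ : (2 * Real.pi) ≠ 0 := by positivity
  -- The kernel `e^{-2πi v·w}` of `𝓕` accounts for the dilation by `2π`. Integrability of `p_t` thus
  -- makes `𝓕 q` integrable, and the inversion theorem applies.
  have hF : ∀ w : 𝔼, 𝓕 q w =
      (((2 * Real.pi) ^ d * transitionDensity ν t ((2 * Real.pi) • w) : ℝ) : ℂ) := fun w => by
    rw [Real.fourier_eq', hν.transitionDensity_eq hHW ht, mul_inv_cancel_left₀ (by positivity)]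
    have h := integral_cexp_mul_of_even hqi (fun ξ => by rw [levyExponent_neg])
      (-((2 * Real.pi) • w))
    simp only [inner_neg_right (𝕜 := ℝ), Real.cos_neg] at h
    rw [← h]
    congr 1
    ext v
    rw [smul_eq_mul, inner_smul_right]
    congr 3
    push_cast
    ring
  have hFi : Integrable (𝓕 q) := by
    rw [funext hF]
    exact ((hpi.comp_smul hπ).const_mul _).ofReal
  have hinv := Continuous.fourierInv_fourier_eq
    (Complex.continuous_ofReal.comp (hν.continuous_exp_neg_mul_levyExponent t)) hqi.ofReal hFi
  have h1 := congrFun hinv ξ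
  rw [Real.fourierInv_eq'] at h1
  have h2 := integral_cexp_mul_of_even hpi (hν.transitionDensity_neg hHW ht) ξ
  have h3 := Measure.integral_comp_smul (volume : Measure 𝔼) (fun x : 𝔼 =>
    Complex.exp (((inner ℝ x ξ : ℝ) : ℂ) * Complex.I) * (transitionDensity ν t x : ℂ)) (2 * Real.pi)
  rw [h2] at h3
  have h4 : ∀ v : 𝔼, Complex.exp (((2 * Real.pi * inner ℝ v ξ : ℝ) : ℂ) * Complex.I) • 𝓕 q v =
      ((2 * Real.pi) ^ d : ℝ) • (Complex.exp (((inner ℝ ((2 * Real.pi) • v) ξ : ℝ) : ℂ) * Complex.I) *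
        (transitionDensity ν t ((2 * Real.pi) • v) : ℂ)) := fun v => by
    rw [hF, real_inner_smul_left, smul_eq_mul, Complex.real_smul]
    push_cast
    ring
  change ∫ v : 𝔼, Complex.exp (((2 * Real.pi * inner ℝ v ξ : ℝ) : ℂ) * Complex.I) • 𝓕 q v = _ at h1
  simp_rw [h4] at h1
  rw [integral_smul, h3, finrank_euclideanSpace_fin, abs_of_pos (by positivity), smul_smul,
    mul_inv_cancel₀ (by positivity), one_smul] at h1
  exact Complex.ofReal_injective h1

theorem IsSymmLevyDensity.integral_transitionDensity (hν : IsSymmLevyDensity ν)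
    (hHW : HartmanWintner ν) (hP1 : ConditionP1 ν) {t : ℝ} (ht : 0 < t) :
    ∫ x : 𝔼, transitionDensity ν t x = 1 := by
  have h := hν.cosTransform_transitionDensity hHW hP1 ht 0
  simpa [levyExponent] using h

/-- Only `p_t(x - w)` is replaced by its Fourier integral. After Fubini the integral in `w` is the
characteristic function of `p_s`, the sine part vanishing by symmetry, and the exponentials
multiply. -/
theorem IsSymmLevyDensity.chapmanKolmogorov (hν : IsSymmLevyDensity ν)
    (hHW : HartmanWintner ν) (hP1 : ConditionP1 ν) {s t : ℝ} (hs : 0 < s) (ht : 0 < t) (x : 𝔼) :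
    ∫ w : 𝔼, transitionDensity ν s w * transitionDensity ν t (x - w) =
      transitionDensity ν (t + s) x := by
  have hps := hν.integrable_transitionDensity hHW hP1 hs
  have hqt := hν.integrable_exp_neg_mul_levyExponent hHW ht
  have hprod : Integrable (fun q : 𝔼 × 𝔼 => Real.cos (inner ℝ q.2 (x - q.1)) *
      (transitionDensity ν s q.1 * Real.exp (-(t * levyExponent ν q.2))))
      (volume.prod volume) :=
    (hps.mul_prod hqt).bdd_mul (c := 1) (by fun_prop)
      (ae_of_all _ fun q => Real.abs_cos_le_one _)
  have h1 : ∀ w : 𝔼, transitionDensity ν s w * transitionDensity ν t (x - w) =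
      ((2 * Real.pi) ^ d)⁻¹ * ∫ ξ : 𝔼, Real.cos (inner ℝ ξ (x - w)) *
        (transitionDensity ν s w * Real.exp (-(t * levyExponent ν ξ))) := fun w => by
    rw [hν.transitionDensity_eq hHW ht, mul_left_comm, ← integral_const_mul]
    congr 2
    ext ξ
    ring
  simp_rw [h1]
  rw [integral_const_mul, integral_integral_swap hprod, hν.transitionDensity_eq hHW (by positivity)]
  congr 2
  ext ξ
  have h2 : ∀ w : 𝔼, Real.cos (inner ℝ ξ (x - w)) *
      (transitionDensity ν s w * Real.exp (-(t * levyExponent ν ξ))) =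
      Real.cos (inner ℝ ξ x) * Real.exp (-(t * levyExponent ν ξ)) *
        (Real.cos (inner ℝ w ξ) * transitionDensity ν s w) +
      Real.sin (inner ℝ ξ x) * Real.exp (-(t * levyExponent ν ξ)) *
        (Real.sin (inner ℝ w ξ) * transitionDensity ν s w) := fun w => by
    rw [inner_sub_right, Real.cos_sub, real_inner_comm ξ w]; ring
  simp_rw [h2]
  rw [integral_add ((integrable_cos_mul hps ξ).const_mul _)
    ((integrable_sin_mul hps ξ).const_mul _), integral_const_mul, integral_const_mul,
    integral_sin_mul_eq_zero (hν.transitionDensity_neg hHW hs),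
    hν.cosTransform_transitionDensity hHW hP1 hs, mul_zero, add_zero, mul_assoc, ← Real.exp_add]
  congr 2
  ring

/-- Integrate (P1) against `min(|z|², 1)`. The bound says that `p_t` concentrates at the origin as
`t → 0`. -/
theorem IsSymmLevyDensity.exists_truncated_moment_le (hν : IsSymmLevyDensity ν)
    (hHW : HartmanWintner ν) (hP1 : ConditionP1 ν) :
    ∃ K : ℝ, ∀ t : ℝ, 0 < t → ∫ z : 𝔼, min (‖z‖ ^ 2) 1 * transitionDensity ν t z ≤ K * t := by
  obtain ⟨c, hc0, hc⟩ := hP1.exists_bound hν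
  refine ⟨c * ∫ z : 𝔼, min (‖z‖ ^ 2) 1 * ν z, fun t ht => ?_⟩
  rw [mul_right_comm, ← integral_const_mul]
  refine integral_mono ?_ (hν.integrable.const_mul _) fun z => ?_
  · refine (hν.integrable_transitionDensity hHW hP1 ht).bdd_mul (c := 1) (by fun_prop)
      (ae_of_all _ fun z => ?_)
    rw [Real.norm_of_nonneg (by positivity)]
    exact min_le_right _ _
  · rcases eq_or_ne z 0 with rfl | hz
    · simp
    · have := mul_le_mul_of_nonneg_left (hc t ht z hz) (by positivity : 0 ≤ min (‖z‖ ^ 2) 1)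
      simp only
      linarith

end Kernel

end HardyStein

namespace HardyStein

/-! ### Bregman divergence of a random vector from its mean. -/

section Bregman

variable {n : ℕ}

theorem norm_signedPow {κ : ℝ} (hκ : 0 < κ) (z : EuclideanSpace ℝ (Fin n)) :
    ‖signedPow κ z‖ = ‖z‖ ^ κ := by
  rcases eq_or_ne z 0 with rfl | hz
  · simp [signedPow, Real.zero_rpow hκ.ne']
  · have hz' : 0 < ‖z‖ := norm_pos_iff.2 hz
    rw [signedPow, norm_smul, Real.norm_of_nonneg (by positivity), ← Real.rpow_add_one hz'.ne',
      sub_add_cancel]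

/-- Only the origin needs care, where the factor `|z|^{κ-1}` may blow up; there the norm `|z|^κ`
tends to zero. -/
theorem continuous_signedPow {κ : ℝ} (hκ : 0 < κ) :
    Continuous (signedPow κ : EuclideanSpace ℝ (Fin n) → EuclideanSpace ℝ (Fin n)) := by
  rw [continuous_iff_continuousAt]
  intro z
  rcases eq_or_ne z 0 with rfl | hz
  · have h0 : signedPow κ (0 : EuclideanSpace ℝ (Fin n)) = 0 := by simp [signedPow]
    rw [ContinuousAt, h0, tendsto_zero_iff_norm_tendsto_zero]
    simp_rw [norm_signedPow hκ]
    have h := (continuous_norm (E := EuclideanSpace ℝ (Fin n))).rpow_const (p := κ)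
      fun _ => Or.inr hκ.le
    have := h.tendsto 0
    rwa [norm_zero, Real.zero_rpow hκ.ne'] at this
  · exact (continuous_norm.continuousAt.rpow_const (Or.inl (norm_ne_zero_iff.2 hz))).smul
      continuousAt_id

theorem continuous_bregman {p : ℝ} (hp : 1 < p) :
    Continuous fun q : EuclideanSpace ℝ (Fin n) × EuclideanSpace ℝ (Fin n) =>
      bregman p q.1 q.2 := by
  have h1 := continuous_signedPow (n := n) (sub_pos.2 hp)
  have h2 : ∀ f : EuclideanSpace ℝ (Fin n) × EuclideanSpace ℝ (Fin n) → ℝ, Continuous f →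
      Continuous fun q => f q ^ p := fun f hf => hf.rpow_const fun _ => Or.inr (by linarith)
  unfold bregman
  exact ((h2 _ (by fun_prop)).sub (h2 _ (by fun_prop))).sub (continuous_const.mul (by fun_prop))

theorem measurable_ofReal_bregman {α : Type*} [MeasurableSpace α] {p : ℝ} (hp : 1 < p)
    {W Z : α → EuclideanSpace ℝ (Fin n)} (hW : Measurable W) (hZ : Measurable Z) :
    Measurable fun a => ENNReal.ofReal (bregman p (W a) (Z a)) := by
  have h : Measurable fun q : EuclideanSpace ℝ (Fin n) × EuclideanSpace ℝ (Fin n) =>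
      ENNReal.ofReal (bregman p q.1 q.2) := (continuous_bregman hp).measurable.ennreal_ofReal
  have h1 := h.comp (hW.prodMk hZ)
  simp only [Function.comp_def] at h1
  exact h1

variable {α : Type*} [MeasurableSpace α] {μ : Measure α} [IsProbabilityMeasure μ]
  {U : α → EuclideanSpace ℝ (Fin n)} {p : ℝ}

theorem integrable_bregman_comp (hU : Integrable U μ) (hUp : Integrable (fun a => ‖U a‖ ^ p) μ)
    (w : EuclideanSpace ℝ (Fin n)) : Integrable (fun a => bregman p w (U a)) μ :=
  (hUp.sub (integrable_const _)).sub
    (((hU.sub (integrable_const _)).const_inner _).const_mul _)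

theorem integral_bregman_comp (hU : Integrable U μ) (hUp : Integrable (fun a => ‖U a‖ ^ p) μ)
    (w : EuclideanSpace ℝ (Fin n)) :
    ∫ a, bregman p w (U a) ∂μ = (∫ a, ‖U a‖ ^ p ∂μ) - ‖w‖ ^ p -
      p * inner ℝ (signedPow (p - 1) w) ((∫ a, U a ∂μ) - w) := by
  unfold bregman
  have hUw : Integrable (fun a => U a - w) μ := hU.sub (integrable_const w)
  have hUpw : Integrable (fun a => ‖U a‖ ^ p - ‖w‖ ^ p) μ := hUp.sub (integrable_const _)
  rw [integral_sub hUpw ((hUw.const_inner _).const_mul _),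
    integral_sub hUp (integrable_const _), integral_const_mul]
  rw [integral_inner hUw, integral_sub hU (integrable_const _)]
  simp

/-- The linear term of the divergence has mean zero when the base point is the mean. -/
theorem lintegral_bregman_mean_add (hp : 1 < p) (hU : Integrable U μ)
    (hUp : Integrable (fun a => ‖U a‖ ^ p) μ) :
    (∫⁻ a, ENNReal.ofReal (bregman p (∫ b, U b ∂μ) (U a)) ∂μ) +
      ENNReal.ofReal (‖∫ b, U b ∂μ‖ ^ p) = ∫⁻ a, ENNReal.ofReal (‖U a‖ ^ p) ∂μ := by
  rw [← ofReal_integral_eq_lintegral_ofReal (integrable_bregman_comp hU hUp _)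
      (ae_of_all _ fun a => bregman_nonneg hp _ _),
    ← ofReal_integral_eq_lintegral_ofReal hUp (ae_of_all _ fun a => by positivity),
    ← ENNReal.ofReal_add (integral_nonneg fun a => bregman_nonneg hp _ _) (by positivity),
    integral_bregman_comp hU hUp]
  simp

/-- The right side exceeds the left by exactly `𝓕_p(w, E U)`, which is nonnegative. -/
theorem lintegral_bregman_mean_le (hp : 1 < p) (hU : Integrable U μ)
    (hUp : Integrable (fun a => ‖U a‖ ^ p) μ) (w : EuclideanSpace ℝ (Fin n)) :
    ∫⁻ a, ENNReal.ofReal (bregman p (∫ b, U b ∂μ) (U a)) ∂μ ≤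
      ∫⁻ a, ENNReal.ofReal (bregman p w (U a)) ∂μ := by
  rw [← ofReal_integral_eq_lintegral_ofReal (integrable_bregman_comp hU hUp _)
      (ae_of_all _ fun a => bregman_nonneg hp _ _),
    ← ofReal_integral_eq_lintegral_ofReal (integrable_bregman_comp hU hUp _)
      (ae_of_all _ fun a => bregman_nonneg hp _ _),
    integral_bregman_comp hU hUp, integral_bregman_comp hU hUp]
  refine ENNReal.ofReal_le_ofReal ?_
  have := bregman_nonneg hp w (∫ b, U b ∂μ)
  unfold bregman at this
  simp only [sub_self, inner_zero_right, mul_zero]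
  linarith

end Bregman

end HardyStein

namespace HardyStein

/-! ### The semigroup on `L^p` of an abstract transition kernel. -/

section Semigroup

variable {d n : ℕ}

local notation "𝔼" => EuclideanSpace ℝ (Fin d)
local notation "𝕎" => EuclideanSpace ℝ (Fin n)

/-- The properties of the family of densities `p_t` that the semigroup theory below relies on. -/
structure IsTransitionKernel (k : ℝ → 𝔼 → ℝ) : Prop where
  measurable : Measurable (Function.uncurry k)
  nonneg : ∀ t, 0 < t → ∀ z, 0 ≤ k t z
  integral_eq_one : ∀ t, 0 < t → ∫ z, k t z = 1
  chapmanKolmogorov : ∀ s t, 0 < s → 0 < t → ∀ x, ∫ w, k s w * k t (x - w) = k (t + s) x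
  continuousAt_time : ∀ t, 0 < t → ∀ z, ContinuousAt (fun s => k s z) t
  exists_majorant : ∀ a b, 0 < a → ∃ (m : 𝔼 → ℝ) (M : ℝ), Measurable m ∧ Integrable m ∧
    (∀ z, 0 ≤ m z) ∧ (∀ z, m z ≤ M) ∧ ∀ t ∈ Set.Icc a b, ∀ z, k t z ≤ m z

theorem IsSymmLevyDensity.isTransitionKernel {ν : 𝔼 → ℝ} (hν : IsSymmLevyDensity ν)
    (hHW : HartmanWintner ν) (hP1 : ConditionP1 ν) : IsTransitionKernel (transitionDensity ν) where
  measurable := hν.measurable_transitionDensity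
  nonneg _ ht := hν.transitionDensity_nonneg hHW ht
  integral_eq_one _ ht := hν.integral_transitionDensity hHW hP1 ht
  chapmanKolmogorov _ _ hs ht := hν.chapmanKolmogorov hHW hP1 hs ht
  continuousAt_time _ ht := hν.continuousAt_transitionDensity_time hHW ht
  exists_majorant _ _ ha := hν.exists_majorant hHW hP1 ha

/-- The action `F ↦ ∫ k_t(y - x) F(y) dy` of a kernel on vector functions. -/
noncomputable def kernelAction (k : ℝ → 𝔼 → ℝ) (t : ℝ) (F : 𝔼 → 𝕎) (x : 𝔼) : 𝕎 :=
  ∫ y, k t (y - x) • F y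

variable {k : ℝ → EuclideanSpace ℝ (Fin d) → ℝ}
  {F : EuclideanSpace ℝ (Fin d) → EuclideanSpace ℝ (Fin n)} {p : ℝ}

theorem IsTransitionKernel.measurable_apply (hk : IsTransitionKernel k) (t : ℝ) :
    Measurable (k t) :=
  hk.measurable.comp measurable_prodMk_left

theorem IsTransitionKernel.integrable (hk : IsTransitionKernel k) {t : ℝ} (ht : 0 < t) :
    Integrable (k t) :=
  Integrable.of_integral_ne_zero (by rw [hk.integral_eq_one t ht]; exact one_ne_zero)

/-- The law `k_t(y - x) dy` at time `t` of the process started at `x`. -/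
noncomputable def kernelMeasure (k : ℝ → 𝔼 → ℝ) (t : ℝ) (x : 𝔼) : Measure 𝔼 :=
  volume.withDensity fun y => ENNReal.ofReal (k t (y - x))

theorem IsTransitionKernel.measurable_ofReal (hk : IsTransitionKernel k) (t : ℝ) (x : 𝔼) :
    Measurable fun y => ENNReal.ofReal (k t (y - x)) := by
  have := hk.measurable_apply t
  fun_prop

theorem IsTransitionKernel.isProbabilityMeasure (hk : IsTransitionKernel k) {t : ℝ} (ht : 0 < t)
    (x : 𝔼) : IsProbabilityMeasure (kernelMeasure k t x) := by
  constructor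
  rw [kernelMeasure, withDensity_apply _ MeasurableSet.univ, Measure.restrict_univ,
    lintegral_sub_right_eq_self (fun z => ENNReal.ofReal (k t z)),
    ← ofReal_integral_eq_lintegral_ofReal (hk.integrable ht) (ae_of_all _ (hk.nonneg t ht)),
    hk.integral_eq_one t ht, ENNReal.ofReal_one]

theorem IsTransitionKernel.lintegral_kernelMeasure (hk : IsTransitionKernel k) (t : ℝ)
    (x : 𝔼) {f : 𝔼 → ENNReal} (hf : Measurable f) :
    ∫⁻ y, f y ∂kernelMeasure k t x = ∫⁻ y, ENNReal.ofReal (k t (y - x)) * f y :=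
  lintegral_withDensity_eq_lintegral_mul _ (hk.measurable_ofReal t x) hf

theorem IsTransitionKernel.integral_kernelMeasure (hk : IsTransitionKernel k) {t : ℝ} (ht : 0 < t)
    (F : 𝔼 → 𝕎) (x : 𝔼) : ∫ y, F y ∂kernelMeasure k t x = kernelAction k t F x := by
  rw [kernelMeasure, integral_withDensity_eq_integral_toReal_smul (hk.measurable_ofReal t x)
    (ae_of_all _ fun _ => ENNReal.ofReal_lt_top), kernelAction]
  congr 1
  ext1 y
  rw [ENNReal.toReal_ofReal (hk.nonneg t ht _)]

theorem IsTransitionKernel.integrable_kernelMeasure_iff (hk : IsTransitionKernel k) {t : ℝ}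
    (ht : 0 < t) {G : Type*} [NormedAddCommGroup G] [NormedSpace ℝ G] {f : 𝔼 → G} {x : 𝔼} :
    Integrable f (kernelMeasure k t x) ↔ Integrable fun y => k t (y - x) • f y := by
  rw [kernelMeasure, integrable_withDensity_iff_integrable_smul' (hk.measurable_ofReal t x)
    (ae_of_all _ fun _ => ENNReal.ofReal_lt_top)]
  refine integrable_congr (ae_of_all _ fun y => ?_)
  simp only
  rw [ENNReal.toReal_ofReal (hk.nonneg t ht _)]

/-- Stands in for Hölder's inequality: for a bounded integrable weight `m`, both `m` and `m|F|^p`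
are integrable. -/
theorem norm_le_one_add_rpow (hp : 1 < p) (w : 𝕎) : ‖w‖ ≤ 1 + ‖w‖ ^ p := by
  rcases le_total ‖w‖ 1 with h | h
  · have : 0 ≤ ‖w‖ ^ p := by positivity
    linarith
  · have := Real.self_le_rpow_of_one_le h hp.le
    linarith

theorem integrable_norm_rpow_of_memLp (hp : 1 < p) (hF : MemLp F (ENNReal.ofReal p) volume) :
    Integrable fun y => ‖F y‖ ^ p := by
  have := hF.integrable_norm_rpow (by simp; linarith) ENNReal.ofReal_ne_top
  rwa [ENNReal.toReal_ofReal (by linarith)] at this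

theorem lintegral_norm_rpow_eq (hp : 1 < p) (F : 𝔼 → 𝕎) :
    ∫⁻ y, ENNReal.ofReal (‖F y‖ ^ p) = eLpNorm F (ENNReal.ofReal p) volume ^ p := by
  rw [eLpNorm_eq_lintegral_rpow_enorm_toReal (by simp; linarith) ENNReal.ofReal_ne_top,
    ENNReal.toReal_ofReal (by linarith), ← ENNReal.rpow_mul, one_div,
    inv_mul_cancel₀ (by linarith), ENNReal.rpow_one]
  congr 1
  ext1 y
  rw [← ofReal_norm, ENNReal.ofReal_rpow_of_nonneg (norm_nonneg _) (by linarith)]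

/-- A bounded integrable weight can be integrated against a function in `L^p`. -/
theorem integrable_mul_norm_of_memLp (hp : 1 < p) (hF : MemLp F (ENNReal.ofReal p) volume)
    {m : 𝔼 → ℝ} (hm : Integrable m) (hm0 : ∀ z, 0 ≤ m z) {M : ℝ} (hM : ∀ z, m z ≤ M)
    (x : 𝔼) : Integrable fun y => m (y - x) * ‖F y‖ := by
  have hmx : Integrable fun y => m (y - x) := hm.comp_sub_right x
  have h1 : Integrable fun y => m (y - x) * ‖F y‖ ^ p :=
    (integrable_norm_rpow_of_memLp hp hF).bdd_mul (c := M) hmx.aestronglyMeasurable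
      (ae_of_all _ fun y => by rw [Real.norm_of_nonneg (hm0 _)]; exact hM _)
  refine (hmx.add h1).mono' (hmx.aestronglyMeasurable.mul hF.1.norm) (ae_of_all _ fun y => ?_)
  rw [Real.norm_of_nonneg (mul_nonneg (hm0 _) (norm_nonneg _))]
  have := mul_le_mul_of_nonneg_left (norm_le_one_add_rpow hp (F y)) (hm0 (y - x))
  simp only [Pi.add_apply]
  linarith

theorem IsTransitionKernel.exists_le (hk : IsTransitionKernel k) {t : ℝ} (ht : 0 < t) :
    ∃ M, ∀ z, k t z ≤ M := by
  obtain ⟨m, M, -, -, -, hM, h⟩ := hk.exists_majorant t t ht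
  exact ⟨M, fun z => (h t ⟨le_rfl, le_rfl⟩ z).trans (hM z)⟩

theorem IsTransitionKernel.integrable_smul (hk : IsTransitionKernel k) (hp : 1 < p)
    (hF : MemLp F (ENNReal.ofReal p) volume) {t : ℝ} (ht : 0 < t) (x : 𝔼) :
    Integrable fun y => k t (y - x) • F y := by
  obtain ⟨M, hM⟩ := hk.exists_le ht
  refine (integrable_mul_norm_of_memLp hp hF (hk.integrable ht) (hk.nonneg t ht) hM x).mono'
    (((hk.integrable ht).comp_sub_right x).aestronglyMeasurable.smul hF.1) (ae_of_all _ fun y => ?_)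
  rw [norm_smul, Real.norm_of_nonneg (hk.nonneg t ht _)]

theorem IsTransitionKernel.integrable_mul_rpow (hk : IsTransitionKernel k) (hp : 1 < p)
    (hF : MemLp F (ENNReal.ofReal p) volume) {t : ℝ} (ht : 0 < t) (x : 𝔼) :
    Integrable fun y => k t (y - x) * ‖F y‖ ^ p := by
  obtain ⟨M, hM⟩ := hk.exists_le ht
  refine (integrable_norm_rpow_of_memLp hp hF).bdd_mul (c := M)
    ((hk.integrable ht).comp_sub_right x).aestronglyMeasurable (ae_of_all _ fun y => ?_)
  rw [Real.norm_of_nonneg (hk.nonneg t ht _)]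
  exact hM _

theorem IsTransitionKernel.measurable_kernelAction (hk : IsTransitionKernel k)
    (hF : Measurable F) : Measurable fun q : ℝ × 𝔼 => kernelAction k q.1 F q.2 := by
  have h : Measurable fun q : (ℝ × 𝔼) × 𝔼 => k q.1.1 (q.2 - q.1.2) • F q.2 := by
    have h1 : Measurable fun q : (ℝ × 𝔼) × 𝔼 => k q.1.1 (q.2 - q.1.2) :=
      hk.measurable.comp (f := fun q : (ℝ × 𝔼) × 𝔼 => (q.1.1, q.2 - q.1.2)) (by fun_prop)
    exact h1.smul (hF.comp measurable_snd)
  exact (h.stronglyMeasurable.integral_prod_right' (ν := (volume : Measure 𝔼))).measurable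

theorem IsTransitionKernel.measurable_kernelAction_apply (hk : IsTransitionKernel k)
    (hF : Measurable F) (t : ℝ) : Measurable (kernelAction k t F) :=
  (hk.measurable_kernelAction hF).comp measurable_prodMk_left

theorem IsTransitionKernel.lintegral_lintegral_mul (hk : IsTransitionKernel k) {t : ℝ}
    (ht : 0 < t) {f : 𝔼 → ENNReal} (hf : Measurable f) :
    ∫⁻ x, ∫⁻ y, ENNReal.ofReal (k t (y - x)) * f y = ∫⁻ y, f y := by
  have hm := hk.measurable_apply t
  rw [lintegral_lintegral_swap (by fun_prop)]
  congr 1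
  ext1 y
  rw [lintegral_mul_const _ (by fun_prop),
    lintegral_sub_left_eq_self (fun z => ENNReal.ofReal (k t z)) y,
    ← ofReal_integral_eq_lintegral_ofReal (hk.integrable ht) (ae_of_all _ (hk.nonneg t ht)),
    hk.integral_eq_one t ht, ENNReal.ofReal_one, one_mul]

/-- The decrease of `‖P_tF‖_p^p` between times `0` and `t`, as a Bregman integral. -/
theorem IsTransitionKernel.lintegral_bregman_add (hk : IsTransitionKernel k) (hp : 1 < p)
    (hFm : Measurable F) (hF : MemLp F (ENNReal.ofReal p) volume) {t : ℝ} (ht : 0 < t) :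
    (∫⁻ x, ∫⁻ y, ENNReal.ofReal (k t (y - x)) *
        ENNReal.ofReal (bregman p (kernelAction k t F x) (F y))) +
      ∫⁻ x, ENNReal.ofReal (‖kernelAction k t F x‖ ^ p) = ∫⁻ x, ENNReal.ofReal (‖F x‖ ^ p) := by
  have hu := hk.measurable_kernelAction_apply hFm t
  -- Spreading `∫ |F|^p` as a double integral against `k_t(y - x)` reduces the claim to a Jensen gap
  -- identity for each `x`.
  rw [← lintegral_add_right _ (by fun_prop),
    ← hk.lintegral_lintegral_mul ht (f := fun y => ENNReal.ofReal (‖F y‖ ^ p)) (by fun_prop)]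
  congr 1
  ext1 x
  have := hk.isProbabilityMeasure ht x
  have hb : Measurable fun y => ENNReal.ofReal (bregman p (kernelAction k t F x) (F y)) :=
    measurable_ofReal_bregman hp measurable_const hFm
  rw [← hk.lintegral_kernelMeasure t x hb, ← hk.lintegral_kernelMeasure t x (by fun_prop),
    ← hk.integral_kernelMeasure ht]
  exact lintegral_bregman_mean_add hp
    ((hk.integrable_kernelMeasure_iff ht).2 (hk.integrable_smul hp hF ht x))
    ((hk.integrable_kernelMeasure_iff ht).2 (hk.integrable_mul_rpow hp hF ht x))

theorem IsTransitionKernel.lintegral_bregman_le (hk : IsTransitionKernel k) (hp : 1 < p)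
    (hFm : Measurable F) (hF : MemLp F (ENNReal.ofReal p) volume) {t : ℝ} (ht : 0 < t)
    (w : 𝕎) (x : 𝔼) :
    ∫⁻ y, ENNReal.ofReal (k t (y - x)) *
        ENNReal.ofReal (bregman p (kernelAction k t F x) (F y)) ≤
      ∫⁻ y, ENNReal.ofReal (k t (y - x)) * ENNReal.ofReal (bregman p w (F y)) := by
  have := hk.isProbabilityMeasure ht x
  have hb : ∀ w : 𝕎, Measurable fun y => ENNReal.ofReal (bregman p w (F y)) := fun w =>
    measurable_ofReal_bregman hp measurable_const hFm
  rw [← hk.lintegral_kernelMeasure t x (hb _), ← hk.lintegral_kernelMeasure t x (hb _),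
    ← hk.integral_kernelMeasure ht]
  exact lintegral_bregman_mean_le hp
    ((hk.integrable_kernelMeasure_iff ht).2 (hk.integrable_smul hp hF ht x))
    ((hk.integrable_kernelMeasure_iff ht).2 (hk.integrable_mul_rpow hp hF ht x)) w

/-- Drop the Bregman term from `lintegral_bregman_add`. -/
theorem IsTransitionKernel.eLpNorm_kernelAction_le (hk : IsTransitionKernel k) (hp : 1 < p)
    (hFm : Measurable F) (hF : MemLp F (ENNReal.ofReal p) volume) {t : ℝ} (ht : 0 < t) :
    eLpNorm (kernelAction k t F) (ENNReal.ofReal p) volume ≤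
      eLpNorm F (ENNReal.ofReal p) volume := by
  rw [← ENNReal.rpow_le_rpow_iff (by linarith : 0 < p), ← lintegral_norm_rpow_eq hp,
    ← lintegral_norm_rpow_eq hp, ← hk.lintegral_bregman_add hp hFm hF ht]
  exact le_add_self

theorem IsTransitionKernel.memLp_kernelAction (hk : IsTransitionKernel k) (hp : 1 < p)
    (hFm : Measurable F) (hF : MemLp F (ENNReal.ofReal p) volume) {t : ℝ} (ht : 0 < t) :
    MemLp (kernelAction k t F) (ENNReal.ofReal p) volume :=
  ⟨(hk.measurable_kernelAction_apply hFm t).aestronglyMeasurable,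
    (hk.eLpNorm_kernelAction_le hp hFm hF ht).trans_lt hF.2⟩

/-- Fubini and Chapman–Kolmogorov. Absolute integrability follows from the same computation with
norms, which collapses to `k_{t+s}(z - x)|F(z)|`. -/
theorem IsTransitionKernel.kernelAction_add (hk : IsTransitionKernel k) (hp : 1 < p)
    (hFm : Measurable F) (hF : MemLp F (ENNReal.ofReal p) volume) {s t : ℝ} (hs : 0 < s)
    (ht : 0 < t) : kernelAction k s (kernelAction k t F) = kernelAction k (t + s) F := by
  ext1 x
  have hks := hk.measurable_apply s
  have hkt := hk.measurable_apply t
  have hCK : ∀ z, ∫ y, k s (y - x) * k t (z - y) = k (t + s) (z - x) := fun z => by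
    rw [← hk.chapmanKolmogorov s t hs ht (z - x),
      ← integral_sub_right_eq_self (fun w => k s w * k t (z - x - w)) x]
    congr 1
    ext1 y
    congr 2
    abel
  obtain ⟨M, hM⟩ := hk.exists_le ht
  have hprod : Integrable (fun q : 𝔼 × 𝔼 => (k s (q.1 - x) * k t (q.2 - q.1)) • F q.2)
      (volume.prod volume) := by
    rw [integrable_prod_iff' (by fun_prop)]
    refine ⟨ae_of_all _ fun z => ?_, ?_⟩
    · change Integrable fun y => (k s (y - x) * k t (z - y)) • F z
      refine Integrable.smul_const ?_ _
      refine ((hk.integrable hs).comp_sub_right x).mul_bdd (c := M)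
        (hkt.comp (measurable_const.sub measurable_id)).aestronglyMeasurable
        (ae_of_all _ fun y => ?_)
      rw [Real.norm_of_nonneg (hk.nonneg t ht _)]
      exact hM _
    · have h1 : ∀ z, ∫ y, ‖(k s (y - x) * k t (z - y)) • F z‖ = ‖k (t + s) (z - x) • F z‖ :=
        fun z => by
          rw [norm_smul, Real.norm_of_nonneg (hk.nonneg _ (by positivity) _), ← hCK,
            ← integral_mul_const]
          congr 1
          ext1 y
          rw [norm_smul, Real.norm_of_nonneg (mul_nonneg (hk.nonneg s hs _) (hk.nonneg t ht _))]
      simp only [h1]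
      exact (hk.integrable_smul hp hF (by positivity) x).norm
  calc kernelAction k s (kernelAction k t F) x
      = ∫ y, ∫ z, (k s (y - x) * k t (z - y)) • F z := by
        simp only [kernelAction, mul_smul, integral_smul]
    _ = ∫ z, ∫ y, (k s (y - x) * k t (z - y)) • F z := integral_integral_swap hprod
    _ = kernelAction k (t + s) F x := by
        simp only [integral_smul_const, hCK, kernelAction]

theorem IsTransitionKernel.continuousAt_kernelAction (hk : IsTransitionKernel k) (hp : 1 < p)
    (hF : MemLp F (ENNReal.ofReal p) volume) {t : ℝ} (ht : 0 < t) (x : 𝔼) :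
    ContinuousAt (fun s => kernelAction k s F x) t := by
  obtain ⟨m, M, hmm, hmi, hm0, hM, h⟩ := hk.exists_majorant (t / 2) (t + 1) (half_pos ht)
  have hm := fun s => hk.measurable_apply s
  refine continuousAt_of_dominated (bound := fun y => m (y - x) * ‖F y‖)
    (Eventually.of_forall fun s => ?_) ?_ (integrable_mul_norm_of_memLp hp hF hmi hm0 hM x)
    (ae_of_all _ fun y => (hk.continuousAt_time t ht _).smul continuousAt_const)
  · have : Measurable fun y => k s (y - x) := by have := hm s; fun_prop
    exact this.aestronglyMeasurable.smul hF.1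
  · filter_upwards [Icc_mem_nhds (half_lt_self ht) (lt_add_one t)] with s hs
    refine ae_of_all _ fun y => ?_
    rw [norm_smul, Real.norm_of_nonneg (hk.nonneg s (by linarith [hs.1]) _)]
    exact mul_le_mul_of_nonneg_right (h s hs _) (norm_nonneg _)

theorem IsTransitionKernel.kernelAction_sub (hk : IsTransitionKernel k) (hp : 1 < p)
    {G : 𝔼 → 𝕎} (hF : MemLp F (ENNReal.ofReal p) volume)
    (hG : MemLp G (ENNReal.ofReal p) volume) {t : ℝ} (ht : 0 < t) :
    kernelAction k t (F - G) = kernelAction k t F - kernelAction k t G := by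
  ext1 x
  simp only [kernelAction, Pi.sub_apply, smul_sub]
  exact integral_sub (hk.integrable_smul hp hF ht x) (hk.integrable_smul hp hG ht x)

end Semigroup

end HardyStein

namespace HardyStein

/-! ### Behaviour of the semigroup at infinite and at zero time. -/

section Asymptotics

variable {d n : ℕ}

local notation "𝔼" => EuclideanSpace ℝ (Fin d)
local notation "𝕎" => EuclideanSpace ℝ (Fin n)

variable {k : ℝ → EuclideanSpace ℝ (Fin d) → ℝ}
  {F : EuclideanSpace ℝ (Fin d) → EuclideanSpace ℝ (Fin n)} {p : ℝ}

/-- Interpolation between `L^1` and `L^∞`: of the factors `|P_tG|^{p-1}` and `|P_tG|`, the first is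
bounded using `k_t ≤ B`, and the second integrates to at most the `L^1` norm of `G`. -/
theorem IsTransitionKernel.eLpNorm_rpow_le_of_bound (hk : IsTransitionKernel k) (hp : 1 < p)
    {G : 𝔼 → 𝕎} (hG : Measurable G) {t : ℝ} (ht : 0 < t) {B : ℝ} (hB : ∀ z, k t z ≤ B) :
    eLpNorm (kernelAction k t G) (ENNReal.ofReal p) volume ^ p ≤
      (ENNReal.ofReal B * ∫⁻ y, ‖G y‖ₑ) ^ (p - 1) * ∫⁻ y, ‖G y‖ₑ := by
  have hN : ∀ x, ‖kernelAction k t G x‖ₑ ≤ ∫⁻ y, ENNReal.ofReal (k t (y - x)) * ‖G y‖ₑ := fun x => by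
    refine (enorm_integral_le_lintegral_enorm _).trans_eq ?_
    congr 1
    ext1 y
    rw [enorm_smul, Real.enorm_of_nonneg (hk.nonneg t ht _)]
  have hm := hk.measurable_apply t
  have hN2 : ∀ x, ‖kernelAction k t G x‖ₑ ≤ ENNReal.ofReal B * ∫⁻ y, ‖G y‖ₑ := fun x => by
    refine (hN x).trans ?_
    rw [← lintegral_const_mul _ (by fun_prop)]
    exact lintegral_mono fun y => mul_le_mul_left (ENNReal.ofReal_le_ofReal (hB _)) _
  rw [← lintegral_norm_rpow_eq hp,
    ← hk.lintegral_lintegral_mul ht (f := fun y => ‖G y‖ₑ) (by fun_prop),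
    ← lintegral_const_mul _ (by fun_prop), hk.lintegral_lintegral_mul ht (by fun_prop)]
  refine lintegral_mono fun x => ?_
  rw [← ENNReal.ofReal_rpow_of_nonneg (norm_nonneg _) (by linarith), ofReal_norm]
  calc ‖kernelAction k t G x‖ₑ ^ p
      = ‖kernelAction k t G x‖ₑ ^ (p - 1) * ‖kernelAction k t G x‖ₑ := by
        conv_lhs => rw [← sub_add_cancel p 1]
        rw [ENNReal.rpow_add_of_nonneg _ _ (by linarith) zero_le_one, ENNReal.rpow_one]
    _ ≤ _ := mul_le_mul' (ENNReal.rpow_le_rpow (hN2 x) (by linarith)) (hN x)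

theorem tendsto_zero_of_tendsto_rpow_zero {ι : Type*} {l : Filter ι} {f : ι → ENNReal}
    (hp : 0 < p) (h : Tendsto (fun i => f i ^ p) l (𝓝 0)) : Tendsto f l (𝓝 0) := by
  have h1 := h.ennrpow_const p⁻¹
  rw [ENNReal.zero_rpow_of_pos (by positivity)] at h1
  refine h1.congr fun i => ?_
  rw [← ENNReal.rpow_mul, mul_inv_cancel₀ hp.ne', ENNReal.rpow_one]

/-- Strong stability: the semigroup tends to zero in `L^p` as time tends to infinity. -/
theorem IsTransitionKernel.tendsto_eLpNorm_kernelAction (hk : IsTransitionKernel k) (hp : 1 < p)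
    (hFm : Measurable F) (hF : MemLp F (ENNReal.ofReal p) volume) {B : ℝ → ℝ}
    (hB : ∀ t, 0 < t → ∀ z, k t z ≤ B t) (hB0 : Tendsto B atTop (𝓝 0)) :
    Tendsto (fun t => eLpNorm (kernelAction k t F) (ENNReal.ofReal p) volume) atTop (𝓝 0) := by
  rw [ENNReal.tendsto_nhds_zero]
  intro ε hε
  have hε2 : ε / 2 ≠ 0 := (ENNReal.half_pos hε.ne').ne'
  -- For the compactly supported `G` the `L^1` bound decays with `B t`; the error `F - G` stays
  -- small uniformly in time by contractivity.
  obtain ⟨G, hGs, hFG, hGc, hG⟩ := hF.exists_hasCompactSupport_eLpNorm_sub_le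
    ENNReal.ofReal_ne_top hε2
  have hGm := hGc.measurable
  have hI : ∫⁻ y, ‖G y‖ₑ ≠ ⊤ := (hGc.integrable_of_hasCompactSupport hGs).2.ne
  have hlim : Tendsto (fun t => eLpNorm (kernelAction k t G) (ENNReal.ofReal p) volume) atTop
      (𝓝 0) := by
    refine tendsto_zero_of_tendsto_rpow_zero (p := p) (by linarith) ?_
    have h1 : Tendsto (fun t => (ENNReal.ofReal (B t) * ∫⁻ y, ‖G y‖ₑ) ^ (p - 1) * ∫⁻ y, ‖G y‖ₑ)
        atTop (𝓝 ((ENNReal.ofReal 0 * ∫⁻ y, ‖G y‖ₑ) ^ (p - 1) * ∫⁻ y, ‖G y‖ₑ)) :=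
      ENNReal.Tendsto.mul_const ((ENNReal.Tendsto.mul_const (ENNReal.tendsto_ofReal hB0)
        (Or.inr hI)).ennrpow_const _) (Or.inr hI)
    rw [ENNReal.ofReal_zero, zero_mul, ENNReal.zero_rpow_of_pos (by linarith), zero_mul] at h1
    refine tendsto_of_tendsto_of_tendsto_of_le_of_le' tendsto_const_nhds h1
      (Eventually.of_forall fun t => zero_le) ?_
    filter_upwards [eventually_gt_atTop 0] with t ht
    exact hk.eLpNorm_rpow_le_of_bound hp hGm ht (hB t ht)
  filter_upwards [ENNReal.tendsto_nhds_zero.1 hlim _ (ENNReal.half_pos hε.ne'),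
    eventually_gt_atTop 0] with t h1 ht
  have h2 : kernelAction k t F = kernelAction k t (F - G) + kernelAction k t G := by
    rw [hk.kernelAction_sub hp hF hG ht, sub_add_cancel]
  rw [h2]
  refine (eLpNorm_add_le (hk.measurable_kernelAction_apply (hFm.sub hGm) t).aestronglyMeasurable
    (hk.measurable_kernelAction_apply hGm t).aestronglyMeasurable (by simp; linarith)).trans ?_
  rw [← ENNReal.add_halves ε]
  exact add_le_add ((hk.eLpNorm_kernelAction_le hp (hFm.sub hGm) (hF.sub hG) ht).trans hFG) h1

/-- Within `δ` of `x` continuity gives `ε`; farther away the trivial bound `2M` is absorbed, since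
there the truncated square is at least `min(δ², 1)`. -/
theorem exists_norm_sub_le_add_min {G : 𝔼 → 𝕎} (hGc : Continuous G) (hGs : HasCompactSupport G)
    (x : 𝔼) {ε : ℝ} (hε : 0 < ε) :
    ∃ C : ℝ, 0 ≤ C ∧ ∀ y, ‖G y - G x‖ ≤ ε + C * min (‖y - x‖ ^ 2) 1 := by
  obtain ⟨M, hM⟩ := hGs.exists_bound_of_continuous hGc
  obtain ⟨δ, hδ, h⟩ := Metric.continuousAt_iff.1 (hGc.continuousAt (x := x)) ε hε
  have hM0 : 0 ≤ M := (norm_nonneg _).trans (hM x)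
  have hmin : 0 < min (δ ^ 2) 1 := by positivity
  refine ⟨2 * M / min (δ ^ 2) 1, by positivity, fun y => ?_⟩
  rcases lt_or_ge (dist y x) δ with hy | hy
  · have h1 := (h hy).le
    rw [dist_eq_norm] at h1
    have : 0 ≤ 2 * M / min (δ ^ 2) 1 * min (‖y - x‖ ^ 2) 1 := by positivity
    linarith
  · have h1 : min (δ ^ 2) 1 ≤ min (‖y - x‖ ^ 2) 1 := by
      rw [dist_eq_norm] at hy
      gcongr
    have h2 : 2 * M ≤ 2 * M / min (δ ^ 2) 1 * min (‖y - x‖ ^ 2) 1 := by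
      rw [div_mul_eq_mul_div, le_div_iff₀ hmin]
      gcongr
    have h3 := (norm_sub_le (G y) (G x)).trans (add_le_add (hM y) (hM x))
    linarith

/-- Averaging the previous bound with tolerance `ε/2` leaves `ε/2` plus `C` times the truncated
moment, which is at most `K t`. -/
theorem IsTransitionKernel.tendsto_kernelAction_zero (hk : IsTransitionKernel k)
    {G : 𝔼 → 𝕎} (hGc : Continuous G) (hGs : HasCompactSupport G) {K : ℝ}
    (hK : ∀ t, 0 < t → ∫ z, min (‖z‖ ^ 2) 1 * k t z ≤ K * t) (x : 𝔼) :
    Tendsto (fun t => kernelAction k t G x) (𝓝[>] 0) (𝓝 (G x)) := by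
  rw [Metric.tendsto_nhds]
  intro ε hε
  obtain ⟨C, hC0, hC⟩ := exists_norm_sub_le_add_min hGc hGs x (half_pos hε)
  obtain ⟨M, hM⟩ := hGs.exists_bound_of_continuous hGc
  have hsmall : ∀ᶠ t in 𝓝[>] (0 : ℝ), C * (K * t) < ε / 2 := by
    have : Tendsto (fun t : ℝ => C * (K * t)) (𝓝 0) (𝓝 (C * (K * 0))) :=
      (by fun_prop : Continuous fun t : ℝ => C * (K * t)).tendsto 0
    rw [mul_zero, mul_zero] at this
    exact (this.mono_left nhdsWithin_le_nhds).eventually_lt_const (half_pos hε)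
  filter_upwards [hsmall, self_mem_nhdsWithin] with t hts ht
  have ht : 0 < t := ht
  have hki := (hk.integrable ht).comp_sub_right x
  have h1 : ∫ y, k t (y - x) = 1 := by
    rw [integral_sub_right_eq_self (k t) x, hk.integral_eq_one t ht]
  have hGi : Integrable fun y => k t (y - x) • G y :=
    hki.smul_bdd M hGc.aestronglyMeasurable (ae_of_all _ hM)
  have hmi : Integrable fun z => min (‖z‖ ^ 2) 1 * k t z :=
    (hk.integrable ht).bdd_mul (c := 1) (by fun_prop) (ae_of_all _ fun z => by
      rw [Real.norm_of_nonneg (by positivity)]; exact min_le_right _ _)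
  have h2 : kernelAction k t G x - G x = ∫ y, k t (y - x) • (G y - G x) := by
    simp only [smul_sub]
    rw [integral_sub hGi (hki.smul_const _), integral_smul_const, h1, one_smul, kernelAction]
  rw [dist_eq_norm, h2]
  calc ‖∫ y, k t (y - x) • (G y - G x)‖
      ≤ ∫ y, (ε / 2 * k t (y - x) + C * (min (‖y - x‖ ^ 2) 1 * k t (y - x))) := by
        refine norm_integral_le_of_norm_le
          ((hki.const_mul _).add ((hmi.comp_sub_right x).const_mul _)) (ae_of_all _ fun y => ?_)
        rw [norm_smul, Real.norm_of_nonneg (hk.nonneg t ht _)]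
        have := mul_le_mul_of_nonneg_left (hC y) (hk.nonneg t ht (y - x))
        linarith
    _ = ε / 2 + C * ∫ z, min (‖z‖ ^ 2) 1 * k t z := by
        rw [integral_add (hki.const_mul _) ((hmi.comp_sub_right x).const_mul _),
          integral_const_mul, integral_const_mul, h1, mul_one,
          integral_sub_right_eq_self (fun z => min (‖z‖ ^ 2) 1 * k t z) x]
    _ < ε := by
        have := mul_le_mul_of_nonneg_left (hK t ht) hC0
        linarith

/-- Lower semicontinuity at time zero of the `L^p` norm along the semigroup. -/
theorem IsTransitionKernel.eLpNorm_le_of_tendsto (hk : IsTransitionKernel k) (hp : 1 < p)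
    (hFm : Measurable F) (hF : MemLp F (ENNReal.ofReal p) volume) {K : ℝ}
    (hK : ∀ t, 0 < t → ∫ z, min (‖z‖ ^ 2) 1 * k t z ≤ K * t) {s : ℕ → ℝ}
    (hs : ∀ m, 0 < s m) (hs0 : Tendsto s atTop (𝓝 0)) {a : ℕ → ENNReal} {A : ENNReal}
    (ha : ∀ m, eLpNorm (kernelAction k (s m) F) (ENNReal.ofReal p) volume ≤ a m)
    (haA : Tendsto a atTop (𝓝 A)) :
    eLpNorm F (ENNReal.ofReal p) volume ≤ A := by
  have hp1 : 1 ≤ ENNReal.ofReal p := by simp; linarith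
  refine ENNReal.le_of_forall_pos_le_add fun ε hε _ => ?_
  have hε2 : (ε / 2 : ENNReal) ≠ 0 := (ENNReal.half_pos (by exact_mod_cast hε.ne')).ne'
  -- Pointwise convergence at time zero is available for continuous compactly supported functions,
  -- so Fatou is applied to `G`. Passing from `F` to `G` and back costs `ε/2` each time.
  obtain ⟨G, hGs, hFG, hGc, hG⟩ := hF.exists_hasCompactSupport_eLpNorm_sub_le
    ENNReal.ofReal_ne_top hε2
  have hGm := hGc.measurable
  have hs' : Tendsto s atTop (𝓝[>] 0) :=
    tendsto_nhdsWithin_iff.2 ⟨hs0, Eventually.of_forall hs⟩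
  have hbound : ∀ m, eLpNorm (kernelAction k (s m) G) (ENNReal.ofReal p) volume ≤ a m + ε / 2 := by
    intro m
    have h2 : kernelAction k (s m) G = kernelAction k (s m) F - kernelAction k (s m) (F - G) := by
      rw [hk.kernelAction_sub hp hF hG (hs m), sub_sub_cancel]
    rw [h2]
    exact (eLpNorm_sub_le (hk.measurable_kernelAction_apply hFm _).aestronglyMeasurable
      (hk.measurable_kernelAction_apply (hFm.sub hGm) _).aestronglyMeasurable hp1).trans
      (add_le_add (ha m)
        ((hk.eLpNorm_kernelAction_le hp (hFm.sub hGm) (hF.sub hG) (hs m)).trans hFG))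
  have hGA : eLpNorm G (ENNReal.ofReal p) volume ≤ A + ε / 2 := by
    refine (Lp.eLpNorm_lim_le_liminf_eLpNorm
      (fun m => (hk.measurable_kernelAction_apply hGm (s m)).aestronglyMeasurable) G
      (ae_of_all _ fun x => (hk.tendsto_kernelAction_zero hGc hGs hK x).comp hs')).trans ?_
    rw [← (haA.add_const (ε / 2 : ENNReal)).liminf_eq]
    exact liminf_le_liminf (Eventually.of_forall hbound)
  calc eLpNorm F (ENNReal.ofReal p) volume
      = eLpNorm (F - G + G) (ENNReal.ofReal p) volume := by rw [sub_add_cancel]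
    _ ≤ eLpNorm (F - G) (ENNReal.ofReal p) volume + eLpNorm G (ENNReal.ofReal p) volume :=
        eLpNorm_add_le (hF.sub hG).1 hG.1 hp1
    _ ≤ ε / 2 + (A + ε / 2) := add_le_add hFG hGA
    _ = A + ε := by rw [add_left_comm, ENNReal.add_halves]

end Asymptotics

end HardyStein

namespace HardyStein

/-! ### Telescoping of time increments. -/

section Telescoping

theorem setLIntegral_Ioc_add_right (h : ℝ → ENNReal) (s T : ℝ) :
    ∫⁻ t in Set.Ioc 0 T, h (t + s) = ∫⁻ t in Set.Ioc s (T + s), h t := by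
  rw [← lintegral_indicator measurableSet_Ioc, ← lintegral_indicator measurableSet_Ioc,
    ← lintegral_add_right_eq_self (fun t => (Set.Ioc s (T + s)).indicator h t) s]
  congr 1
  ext1 t
  simp only [Set.indicator_apply, Set.mem_Ioc, add_le_add_iff_right, lt_add_iff_pos_left]

theorem setLIntegral_Ioc_add_adjacent (h : ℝ → ENNReal) {a b c : ℝ} (hab : a ≤ b) (hbc : b ≤ c) :
    (∫⁻ t in Set.Ioc a b, h t) + ∫⁻ t in Set.Ioc b c, h t = ∫⁻ t in Set.Ioc a c, h t := by
  rw [← Set.Ioc_union_Ioc_eq_Ioc hab hbc, lintegral_union measurableSet_Ioc]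
  exact Set.Ioc_disjoint_Ioc_of_le le_rfl

variable {h G : ℝ → ENNReal} {H : ENNReal} {s : ℝ}

/-- Integrating `h t - h (t + s)` over `(0, T]` leaves only the two end intervals of length `s`. The
additive form avoids truncated subtraction; the bound `H` gives the finiteness needed to cancel. -/
theorem setLIntegral_Ioc_increment_add (hs : 0 < s) (hH : H ≠ ⊤) (hm : Measurable h)
    (hle : ∀ t, 0 < t → h t ≤ H) (hG : ∀ t, 0 < t → G t + h (t + s) = h t) {T : ℝ} (hT : 0 ≤ T) :
    (∫⁻ t in Set.Ioc 0 T, G t) + ∫⁻ t in Set.Ioc T (T + s), h t = ∫⁻ t in Set.Ioc 0 s, h t := by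
  have h1 : (∫⁻ t in Set.Ioc 0 T, G t) + ∫⁻ t in Set.Ioc s (T + s), h t =
      ∫⁻ t in Set.Ioc 0 T, h t := by
    rw [← setLIntegral_Ioc_add_right, ← lintegral_add_right _ (by fun_prop)]
    exact setLIntegral_congr_fun measurableSet_Ioc fun t ht => hG t ht.1
  have h2 := setLIntegral_Ioc_add_adjacent h hs.le (by linarith : s ≤ T + s)
  have h3 := setLIntegral_Ioc_add_adjacent h hT (by linarith : T ≤ T + s)
  have hfin : ∫⁻ t in Set.Ioc s (T + s), h t ≠ ⊤ := by
    refine ne_top_of_le_ne_top (ENNReal.mul_ne_top hH (measure_Ioc_lt_top (μ := (volume : Measure ℝ))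
      (a := s) (b := T + s)).ne)
      ((setLIntegral_mono' (g := fun _ => H) measurableSet_Ioc fun t ht =>
        hle t (hs.trans ht.1)).trans_eq ?_)
    rw [setLIntegral_const]
  rw [← ENNReal.add_left_inj hfin, h2, ← h3, ← h1]
  ring

theorem setLIntegral_increment_le (hs : 0 < s) (hH : H ≠ ⊤) (hm : Measurable h)
    (hle : ∀ t, 0 < t → h t ≤ H) (hG : ∀ t, 0 < t → G t + h (t + s) = h t) :
    ∫⁻ t in Set.Ioi 0, G t ≤ ENNReal.ofReal s * H := by
  have hU : Set.Ioi (0 : ℝ) = ⋃ N : ℕ, Set.Ioc 0 (N : ℝ) := by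
    ext t
    simp only [Set.mem_Ioi, Set.mem_iUnion, Set.mem_Ioc, exists_and_left]
    exact ⟨fun ht => ⟨ht, exists_nat_ge t⟩, fun ht => ht.1⟩
  have hmono : Monotone fun N : ℕ => Set.Ioc 0 (N : ℝ) := fun a b hab =>
    Set.Ioc_subset_Ioc_right (by exact_mod_cast hab)
  -- Exhausting the half-line by a directed union of sets requires no measurability of `G`.
  rw [hU, setLIntegral_iUnion_of_directed _ hmono.directed_le]
  refine iSup_le fun N => ?_
  have h1 := setLIntegral_Ioc_increment_add hs hH hm hle hG (Nat.cast_nonneg N)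
  refine (le_add_right le_rfl).trans (h1.le.trans ?_)
  refine (setLIntegral_mono' (g := fun _ => H) measurableSet_Ioc fun t ht => hle t ht.1).trans_eq ?_
  rw [setLIntegral_const, Real.volume_Ioc, sub_zero, mul_comm]

/-- By monotonicity the initial interval contributes at least `s * h s`, while the tail is at most
`s * h T`, which tends to zero. -/
theorem le_setLIntegral_increment (hs : 0 < s) (hH : H ≠ ⊤) (hm : Measurable h)
    (hle : ∀ t, 0 < t → h t ≤ H) (hanti : ∀ a b, 0 < a → a ≤ b → h b ≤ h a)
    (hG : ∀ t, 0 < t → G t + h (t + s) = h t) (hlim : Tendsto h atTop (𝓝 0)) :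
    ENNReal.ofReal s * h s ≤ ∫⁻ t in Set.Ioi 0, G t := by
  have hlim2 : Tendsto (fun T => (∫⁻ t in Set.Ioi 0, G t) + ENNReal.ofReal s * h T) atTop
      (𝓝 ((∫⁻ t in Set.Ioi 0, G t) + ENNReal.ofReal s * 0)) :=
    (ENNReal.Tendsto.const_mul hlim (Or.inr ENNReal.ofReal_ne_top)).const_add _
  rw [mul_zero, add_zero] at hlim2
  refine ge_of_tendsto hlim2 ?_
  filter_upwards [eventually_gt_atTop 0] with T hT
  calc ENNReal.ofReal s * h s = ∫⁻ _ in Set.Ioc 0 s, h s := by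
        rw [setLIntegral_const, Real.volume_Ioc, sub_zero, mul_comm]
    _ ≤ ∫⁻ t in Set.Ioc 0 s, h t :=
        setLIntegral_mono' measurableSet_Ioc fun t ht => hanti t s ht.1 ht.2
    _ = (∫⁻ t in Set.Ioc 0 T, G t) + ∫⁻ t in Set.Ioc T (T + s), h t :=
        (setLIntegral_Ioc_increment_add hs hH hm hle hG hT.le).symm
    _ ≤ (∫⁻ t in Set.Ioi 0, G t) + ∫⁻ _ in Set.Ioc T (T + s), h T :=
        add_le_add (lintegral_mono_set Set.Ioc_subset_Ioi_self)
          (setLIntegral_mono' measurableSet_Ioc fun t ht => hanti T t hT ht.1.le)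
    _ = _ := by rw [setLIntegral_const, Real.volume_Ioc, add_sub_cancel_left, mul_comm (h T)]

end Telescoping

/-! ### The Hardy–Stein identity. -/

section Main

variable {d n : ℕ}

local notation "𝔼" => EuclideanSpace ℝ (Fin d)
local notation "𝕎" => EuclideanSpace ℝ (Fin n)

/-- At positive times the integral does not see null sets, so `F` may be replaced by a measurable
representative with equality at every `x`. -/
theorem vecSemigroup_eq_kernelAction {ν : 𝔼 → ℝ} (hk : IsTransitionKernel (transitionDensity ν))
    {p : ℝ} (hp : 1 < p) {F F' : 𝔼 → 𝕎} (hFF' : F =ᵐ[volume] F')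
    (hF' : MemLp F' (ENNReal.ofReal p) volume) {t : ℝ} (ht : 0 < t) (x : 𝔼) :
    vecSemigroup ν t F x = kernelAction (transitionDensity ν) t F' x := by
  ext j
  have h : ∫ y, transitionDensity ν t (y - x) * F' y j =
      (∫ y, transitionDensity ν t (y - x) • F' y) j := (EuclideanSpace.proj j : 𝕎 →L[ℝ] ℝ).integral_comp_comm
    (hk.integrable_smul hp hF' ht x)
  simp only [vecSemigroup, semigroup, ht.ne', if_false, kernelAction]
  rw [← h]
  refine integral_congr_ae ?_
  filter_upwards [hFF'] with y hy
  rw [hy, mul_comm]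

variable {k : ℝ → EuclideanSpace ℝ (Fin d) → ℝ} {ν : EuclideanSpace ℝ (Fin d) → ℝ}
  {F : EuclideanSpace ℝ (Fin d) → EuclideanSpace ℝ (Fin n)} {p : ℝ}

/-- The integrand `κ(y - x) 𝓕_p(P_{t+r}F(x), P_tF(y))` of the time-integrated energy, as a function
of `(t, x, y)`. -/
noncomputable def energyIntegrand (κ : 𝔼 → ℝ) (k : ℝ → 𝔼 → ℝ) (F : 𝔼 → 𝕎) (p r : ℝ)
    (q : ℝ × 𝔼 × 𝔼) : ENNReal :=
  ENNReal.ofReal (κ (q.2.2 - q.2.1)) *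
    ENNReal.ofReal (bregman p (kernelAction k (q.1 + r) F q.2.1) (kernelAction k q.1 F q.2.2))

theorem IsTransitionKernel.measurable_energyIntegrand (hk : IsTransitionKernel k) (hp : 1 < p)
    (hF : Measurable F) {κ : 𝔼 → ℝ} (hκ : Measurable κ) (r : ℝ) :
    Measurable (energyIntegrand κ k F p r) := by
  have hu := hk.measurable_kernelAction hF
  have h1 : Measurable fun q : ℝ × 𝔼 × 𝔼 => kernelAction k (q.1 + r) F q.2.1 :=
    hu.comp (f := fun q : ℝ × 𝔼 × 𝔼 => (q.1 + r, q.2.1)) (by fun_prop)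
  have h2 : Measurable fun q : ℝ × 𝔼 × 𝔼 => kernelAction k q.1 F q.2.2 :=
    hu.comp (f := fun q : ℝ × 𝔼 × 𝔼 => (q.1, q.2.2)) (by fun_prop)
  have h3 := measurable_ofReal_bregman hp h1 h2
  unfold energyIntegrand
  fun_prop

theorem IsTransitionKernel.lintegral_energyIntegrand (hk : IsTransitionKernel k) (hp : 1 < p)
    (hF : Measurable F) {κ : 𝔼 → ℝ} (hκ : Measurable κ) (r : ℝ) :
    ∫⁻ q, energyIntegrand κ k F p r q ∂(volume.restrict (Set.Ioi 0)).prod (volume.prod volume) =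
      ∫⁻ t in Set.Ioi 0, ∫⁻ x, ∫⁻ y, ENNReal.ofReal (κ (y - x)) *
        ENNReal.ofReal (bregman p (kernelAction k (t + r) F x) (kernelAction k t F y)) := by
  have hm := hk.measurable_energyIntegrand hp hF hκ r
  rw [lintegral_prod _ hm.aemeasurable]
  congr 1
  ext1 t
  exact lintegral_prod _ (hm.comp (measurable_prodMk_left (x := t))).aemeasurable

/-- The theorem integrates in `x` first, whereas the probabilistic estimates fix `x` and integrate
in `y`. -/
theorem IsTransitionKernel.lintegral_energyIntegrand_symm (hk : IsTransitionKernel k) (hp : 1 < p)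
    (hF : Measurable F) {κ : 𝔼 → ℝ} (hκ : Measurable κ) (r : ℝ) :
    ∫⁻ q, energyIntegrand κ k F p r q ∂(volume.restrict (Set.Ioi 0)).prod (volume.prod volume) =
      ∫⁻ t in Set.Ioi 0, ∫⁻ y, ∫⁻ x, ENNReal.ofReal (κ (y - x)) *
        ENNReal.ofReal (bregman p (kernelAction k (t + r) F x) (kernelAction k t F y)) := by
  have hm := hk.measurable_energyIntegrand hp hF hκ r
  rw [lintegral_prod _ hm.aemeasurable]
  congr 1
  ext1 t
  exact lintegral_prod_symm _ (hm.comp (measurable_prodMk_left (x := t))).aemeasurable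

/-- The Hardy–Stein identity for a transition kernel which is dominated by, and converges to, the
jump density. -/
theorem IsTransitionKernel.hardyStein (hk : IsTransitionKernel k) (hp : 1 < p)
    (hFm : Measurable F) (hF : MemLp F (ENNReal.ofReal p) volume) (hν : Measurable ν)
    {B : ℝ → ℝ} (hB : ∀ t, 0 < t → ∀ z, k t z ≤ B t) (hB0 : Tendsto B atTop (𝓝 0)) {K : ℝ}
    (hK : ∀ t, 0 < t → ∫ z, min (‖z‖ ^ 2) 1 * k t z ≤ K * t) {c : ℝ} (hc0 : 0 ≤ c)
    (hc : ∀ t, 0 < t → ∀ z, z ≠ 0 → k t z ≤ c * ν z * t)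
    (hlim : ∀ z, z ≠ 0 → Tendsto (fun t => k t z / t) (𝓝[>] 0) (𝓝 (ν z))) :
    ∫⁻ x, ENNReal.ofReal (‖F x‖ ^ p) =
      ∫⁻ t in Set.Ioi 0, ∫⁻ y, ∫⁻ x, ENNReal.ofReal (ν (y - x)) *
        ENNReal.ofReal (bregman p (kernelAction k t F x) (kernelAction k t F y)) := by
  have hp0 : 0 < p := by linarith
  set μ : Measure (ℝ × 𝔼 × 𝔼) := (volume.restrict (Set.Ioi 0)).prod (volume.prod volume) with hμ
  have hpos : ∀ᵐ q ∂μ, 0 < q.1 :=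
    Measure.quasiMeasurePreserving_fst.ae (ae_restrict_mem measurableSet_Ioi)
  set s : ℕ → ℝ := fun m => 1 / ((m : ℝ) + 1) with hs_def
  have hs : ∀ m, 0 < s m := fun m => by positivity
  have hs0 : Tendsto s atTop (𝓝 0) := tendsto_one_div_add_atTop_nhds_zero_nat
  have hs' : Tendsto s atTop (𝓝[>] 0) :=
    tendsto_nhdsWithin_iff.2 ⟨hs0, Eventually.of_forall hs⟩
  set κ : ℕ → 𝔼 → ℝ := fun m z => k (s m) z / s m with hκ_def
  have hκm : ∀ m, Measurable (κ m) := fun m => (hk.measurable_apply _).div_const _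
  have hκlim : ∀ z, z ≠ 0 → Tendsto (fun m => ENNReal.ofReal (κ m z)) atTop
      (𝓝 (ENNReal.ofReal (ν z))) := fun z hz => ENNReal.tendsto_ofReal ((hlim z hz).comp hs')
  set e := energyIntegrand ν k F p 0 with he_def
  have hem : Measurable e := hk.measurable_energyIntegrand hp hFm hν 0
  have he : ∫⁻ q, e q ∂μ = ∫⁻ t in Set.Ioi 0, ∫⁻ y, ∫⁻ x, ENNReal.ofReal (ν (y - x)) *
        ENNReal.ofReal (bregman p (kernelAction k t F x) (kernelAction k t F y)) := by
    have := hk.lintegral_energyIntegrand_symm hp hFm hν 0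
    simpa only [add_zero] using this
  rw [← he]
  set H := ∫⁻ x, ENNReal.ofReal (‖F x‖ ^ p) with hH_def
  have hHp : H = eLpNorm F (ENNReal.ofReal p) volume ^ p := lintegral_norm_rpow_eq hp F
  have hH : H ≠ ⊤ := by
    rw [hHp]; exact ENNReal.rpow_ne_top_of_nonneg hp0.le hF.2.ne
  set h : ℝ → ENNReal := fun t => ∫⁻ x, ENNReal.ofReal (‖kernelAction k t F x‖ ^ p) with hh_def
  have hhp : ∀ t, h t = eLpNorm (kernelAction k t F) (ENNReal.ofReal p) volume ^ p := fun t =>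
    lintegral_norm_rpow_eq hp _
  have hhm : Measurable h := by
    have h1 : Measurable fun q : ℝ × 𝔼 => ENNReal.ofReal (‖kernelAction k q.1 F q.2‖ ^ p) := by
      have := hk.measurable_kernelAction hFm
      fun_prop
    exact h1.lintegral_prod_right'
  have hle : ∀ t, 0 < t → h t ≤ H := fun t ht => by
    rw [hhp, hHp]
    exact ENNReal.rpow_le_rpow (hk.eLpNorm_kernelAction_le hp hFm hF ht) hp0.le
  have hincr : ∀ r, 0 < r → ∀ t, 0 < t → (∫⁻ x, ∫⁻ y, ENNReal.ofReal (k r (y - x)) *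
      ENNReal.ofReal (bregman p (kernelAction k (t + r) F x) (kernelAction k t F y))) +
      h (t + r) = h t := fun r hr t ht => by
    have := hk.lintegral_bregman_add hp (hk.measurable_kernelAction_apply hFm t)
      (hk.memLp_kernelAction hp hFm hF ht) hr
    rwa [hk.kernelAction_add hp hFm hF hr ht] at this
  have hanti : ∀ a b, 0 < a → a ≤ b → h b ≤ h a := fun a b ha hab => by
    rcases hab.eq_or_lt with rfl | hab
    · exact le_rfl
    · have := hincr (b - a) (sub_pos.2 hab) a ha
      rw [add_sub_cancel] at this
      rw [← this]
      exact le_add_self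
  have hh0 : Tendsto h atTop (𝓝 0) := by
    have := (hk.tendsto_eLpNorm_kernelAction hp hFm hF hB hB0).ennrpow_const p
    rw [ENNReal.zero_rpow_of_pos hp0] at this
    exact this.congr fun t => (hhp t).symm
  have hfint : ∀ m, ∫⁻ q, energyIntegrand (κ m) k F p (s m) q ∂μ = (ENNReal.ofReal (s m))⁻¹ *
      ∫⁻ t in Set.Ioi 0, ∫⁻ x, ∫⁻ y, ENNReal.ofReal (k (s m) (y - x)) *
        ENNReal.ofReal (bregman p (kernelAction k (t + s m) F x) (kernelAction k t F y)) := by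
    intro m
    rw [← hk.lintegral_energyIntegrand hp hFm (hk.measurable_apply (s m)) (s m),
      ← lintegral_const_mul _ (hk.measurable_energyIntegrand hp hFm (hk.measurable_apply _) _)]
    congr 1
    ext1 q
    simp only [energyIntegrand, hκ_def]
    rw [ENNReal.ofReal_div_of_pos (hs m), ENNReal.div_eq_inv_mul, mul_assoc]
  have hs_ne : ∀ m, ENNReal.ofReal (s m) ≠ 0 := fun m => (ENNReal.ofReal_pos.2 (hs m)).ne'
  have hf_le : ∀ m, ∫⁻ q, energyIntegrand (κ m) k F p (s m) q ∂μ ≤ H := fun m => by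
    rw [hfint, ENNReal.inv_mul_le_iff (hs_ne m) ENNReal.ofReal_ne_top]
    exact setLIntegral_increment_le (hs m) hH hhm hle (hincr _ (hs m))
  have hf_ge : ∀ m, h (s m) ≤ ∫⁻ q, energyIntegrand (κ m) k F p (s m) q ∂μ := fun m => by
    rw [hfint, ← ENNReal.mul_le_iff_le_inv (hs_ne m) ENNReal.ofReal_ne_top]
    exact le_setLIntegral_increment (hs m) hH hhm hle hanti (hincr _ (hs m)) hh0
  -- Moving the base point from the mean `P_{t+s}F(x)` to `P_tF(x)` increases the integral;
  -- afterwards the Bregman factor no longer depends on `m`.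
  have hfg : ∀ m, ∫⁻ q, energyIntegrand (κ m) k F p (s m) q ∂μ ≤
      ∫⁻ q, energyIntegrand (κ m) k F p 0 q ∂μ := fun m => by
    have hκ : ∀ z, ENNReal.ofReal (κ m z) = (ENNReal.ofReal (s m))⁻¹ * ENNReal.ofReal (k (s m) z) :=
      fun z => by rw [ENNReal.ofReal_div_of_pos (hs m), ENNReal.div_eq_inv_mul]
    rw [hk.lintegral_energyIntegrand hp hFm (hκm m), hk.lintegral_energyIntegrand hp hFm (hκm m)]
    refine setLIntegral_mono' measurableSet_Ioi fun t ht => lintegral_mono fun x => ?_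
    simp only [hκ, mul_assoc, add_zero]
    rw [lintegral_const_mul' _ _ (ENNReal.inv_ne_top.2 (hs_ne m)),
      lintegral_const_mul' _ _ (ENNReal.inv_ne_top.2 (hs_ne m)),
      ← hk.kernelAction_add hp hFm hF (hs m) ht]
    exact mul_le_mul_right (hk.lintegral_bregman_le hp (hk.measurable_kernelAction_apply hFm t)
      (hk.memLp_kernelAction hp hFm hF ht) (hs m) _ x) _
  have hbreg : Continuous fun q : 𝕎 × 𝕎 => bregman p q.1 q.2 := continuous_bregman hp
  -- On the diagonal nothing is known about `ν 0` or the limit of the kernels, but the divergence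
  -- vanishes.
  have hdiag : ∀ q : ℝ × 𝔼 × 𝔼, q.2.2 - q.2.1 = 0 → ∀ κ, energyIntegrand κ k F p 0 q = 0 := by
    intro q hq κ
    rw [sub_eq_zero] at hq
    simp [energyIntegrand, hq, bregman]
  -- Fatou's half. It also provides the finiteness of `∫ e` that makes `c * e` an admissible
  -- majorant below.
  have he_le : ∫⁻ q, e q ∂μ ≤ H := by
    have h1 : ∀ᵐ q ∂μ, e q ≤ liminf (fun m => energyIntegrand (κ m) k F p (s m) q) atTop := by
      filter_upwards [hpos] with q hq
      rcases eq_or_ne (q.2.2 - q.2.1) 0 with hz | hz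
      · rw [he_def, hdiag q hz]
        exact zero_le
      · refine le_of_eq (Tendsto.liminf_eq ?_).symm
        have hcont := hk.continuousAt_kernelAction hp hF hq q.2.1
        have h2 : Tendsto (fun m => q.1 + s m) atTop (𝓝 q.1) := by
          simpa using hs0.const_add q.1
        have h3 : Tendsto (fun m => (kernelAction k (q.1 + s m) F q.2.1, kernelAction k q.1 F q.2.2))
            atTop (𝓝 (kernelAction k q.1 F q.2.1, kernelAction k q.1 F q.2.2)) :=
          (hcont.tendsto.comp h2).prodMk_nhds tendsto_const_nhds
        have h4 := (hbreg.tendsto _).comp h3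
        have h5 := ENNReal.Tendsto.mul (hκlim _ hz) (Or.inr ENNReal.ofReal_ne_top)
          (ENNReal.tendsto_ofReal h4) (Or.inr ENNReal.ofReal_ne_top)
        simpa only [he_def, energyIntegrand, add_zero, Function.comp_def] using h5
    calc ∫⁻ q, e q ∂μ
        ≤ ∫⁻ q, liminf (fun m => energyIntegrand (κ m) k F p (s m) q) atTop ∂μ :=
          lintegral_mono_ae h1
      _ ≤ liminf (fun m => ∫⁻ q, energyIntegrand (κ m) k F p (s m) q ∂μ) atTop :=
          lintegral_liminf_le fun m => hk.measurable_energyIntegrand hp hFm (hκm m) _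
      _ ≤ liminf (fun _ : ℕ => H) atTop := liminf_le_liminf (Eventually.of_forall hf_le)
      _ = H := liminf_const H
  have hg_lim : Tendsto (fun m => ∫⁻ q, energyIntegrand (κ m) k F p 0 q ∂μ) atTop
      (𝓝 (∫⁻ q, e q ∂μ)) := by
    refine tendsto_lintegral_of_dominated_convergence (fun q => ENNReal.ofReal c * e q)
      (fun m => hk.measurable_energyIntegrand hp hFm (hκm m) _) (fun m => ae_of_all _ fun q => ?_)
      ?_ (ae_of_all _ fun q => ?_)
    · rcases eq_or_ne (q.2.2 - q.2.1) 0 with hz | hz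
      · rw [hdiag q hz]
        exact zero_le
      · simp only [he_def, energyIntegrand]
        rw [← mul_assoc, ← ENNReal.ofReal_mul hc0]
        refine mul_le_mul_left (ENNReal.ofReal_le_ofReal ?_) _
        rw [hκ_def]
        simp only
        rw [div_le_iff₀ (hs m)]
        exact hc _ (hs m) _ hz
    · rw [lintegral_const_mul _ hem]
      exact ENNReal.mul_ne_top ENNReal.ofReal_ne_top (ne_top_of_le_ne_top hH he_le)
    · rcases eq_or_ne (q.2.2 - q.2.1) 0 with hz | hz
      · rw [he_def, hdiag q hz]
        simp_rw [hdiag q hz]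
        exact tendsto_const_nhds
      · exact ENNReal.Tendsto.mul_const (hκlim _ hz) (Or.inr ENNReal.ofReal_ne_top)
  refine le_antisymm ?_ he_le
  -- Lower semicontinuity is stated for norms, so the energies enter through their `p`-th roots.
  have hroot := hk.eLpNorm_le_of_tendsto hp hFm hF hK hs hs0
    (a := fun m => (∫⁻ q, energyIntegrand (κ m) k F p 0 q ∂μ) ^ p⁻¹) (fun m => ?_)
    (hg_lim.ennrpow_const p⁻¹)
  · rw [hHp]
    have := ENNReal.rpow_le_rpow hroot hp0.le
    rwa [← ENNReal.rpow_mul, inv_mul_cancel₀ hp0.ne', ENNReal.rpow_one] at this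
  · have := ENNReal.rpow_le_rpow ((hf_ge m).trans (hfg m)) (inv_nonneg.2 hp0.le)
    rwa [hhp, ← ENNReal.rpow_mul, mul_inv_cancel₀ hp0.ne', ENNReal.rpow_one] at this

end Main

end HardyStein

theorem theorem3p1 {d n : ℕ} (hd : 1 ≤ d) (hn : 1 ≤ n)
    (ν : EuclideanSpace ℝ (Fin d) → ℝ)
    (hν : HardyStein.IsSymmLevyDensity ν)
    (hHW : HardyStein.HartmanWintner ν)
    (hP1 : HardyStein.ConditionP1 ν)
    (hP2 : HardyStein.ConditionP2 ν)
    {p : ℝ} (hp : 1 < p)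
    (F : EuclideanSpace ℝ (Fin d) → EuclideanSpace ℝ (Fin n))
    (hF : MemLp F (ENNReal.ofReal p) volume) :
    ∫⁻ x, ENNReal.ofReal (‖F x‖ ^ p) =
      ∫⁻ t in Set.Ioi (0 : ℝ), ∫⁻ y, ∫⁻ x,
        ENNReal.ofReal
          (HardyStein.bregman p (HardyStein.vecSemigroup ν t F x) (HardyStein.vecSemigroup ν t F y)
            * ν (y - x)) := by
  have : NeZero d := ⟨by omega⟩
  have hk := hν.isTransitionKernel hHW hP1
  have hae : F =ᵐ[volume] hF.1.mk F := hF.1.ae_eq_mk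
  have hF' : MemLp (hF.1.mk F) (ENNReal.ofReal p) volume := (memLp_congr_ae hae).1 hF
  obtain ⟨K, hK⟩ := hν.exists_truncated_moment_le hHW hP1
  obtain ⟨c, hc0, hc⟩ := hP1.exists_bound hν
  have hmain := hk.hardyStein hp hF.1.stronglyMeasurable_mk.measurable hF' hν.measurable
    (fun t ht => hν.transitionDensity_le hHW ht) (hν.tendsto_densityBound hHW) hK hc0 hc
    (fun z hz => by simpa using hP2 0 z hz.symm)
  have hnorm : ∫⁻ x, ENNReal.ofReal (‖F x‖ ^ p) =
      ∫⁻ x, ENNReal.ofReal (‖hF.1.mk F x‖ ^ p) := by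
    refine lintegral_congr_ae ?_
    filter_upwards [hae] with x hx
    rw [hx]
  rw [hnorm, hmain]
  refine setLIntegral_congr_fun measurableSet_Ioi fun t ht => ?_
  refine lintegral_congr fun y => lintegral_congr fun x => ?_
  rw [ENNReal.ofReal_mul (HardyStein.bregman_nonneg hp _ _), mul_comm,
    HardyStein.vecSemigroup_eq_kernelAction hk hp hae hF' ht,
    HardyStein.vecSemigroup_eq_kernelAction hk hp hae hF' ht]
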